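/- There is an absolute constant $C>0$ with the following property. Let $p\ge 3$ and $n\ge 1$ be integers. Let $x$ be a (possibly degenerate) Gaussian random vector in $\mathbb{R}^p$ with mean zero, let $x_1,\dots,x_n$ be independent random vectors with the same distribution as $x$, and put $$\Sigma := \mathbb{E}(xx^*),\qquad \widehat\Sigma_n := \frac1n\sum_{i=1}^n x_i x_i^* .$$ Write $\odot$ for the entrywise product of matrices, $\|A\|$ for the spectral norm, $\|A\|_{\max} := \max_{i,j}|a_{ij}|$ and $\|A\|_{1\to 2} := \max_j\bigl(\sum_i a_{ij}^2\bigr)^{1/2}$. If $\Sigma=0$, read $\|\Sigma\|_{\max}/\|\Sigma\|$ as $0$. 1. For every symmetric real $p\times p$ matrix $M$, $\mathbb{E}\,\|M\odot\widehat\Sigma_n-M\odot\Sigma\|^2<\infty$ and $$\Bigl[\mathbb{E}\,\bigl\|M\odot\widehat\Sigma_n-M\odot\Sigma\bigr\|^2\Bigr]^{1/2}\le C\left[\left(\frac{\|\Sigma\|_{\max}}{\|\Sigma\|}\cdot\frac{\|M\|_{1\to2}^2\log p}{n}\right)^{1/2}+\frac{\|\Sigma\|_{\max}}{\|\Sigma\|}\cdot\frac{\|M\|\,\log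 p\,\log(np)}{n}\right]\|\Sigma\|.$$ 2. Let $B=2b+1$ with an integer $b\ge 0$, and let $M$ be a banded mask of bandwidth $B$, i.e. a symmetric matrix with entries in $\{0,1\}$ such that $m_{ij}=0$ whenever $|i-j|>b$. Let $\varepsilon\in(0,1)$. If $$n\ge C\left[\frac{B\log p}{\varepsilon^2}+\frac{B\log^2p}{\varepsilon}\right]\frac{\|\Sigma\|_{\max}}{\|\Sigma\|},\qquad\text{or if}\qquad n\ge C\,\frac{B\log^2 p}{\varepsilon^2},$$ then $$\Bigl[\mathbb{E}\,\bigl\|M\odot\widehat\Sigma_n-M\odot\Sigma\bigr\|^2\Bigr]^{1/2}\le\varepsilon\|\Sigma\|\qquad\text{and}\qquad\mathbb{P}\bigl\{\|M\odot\widehat\Sigma_n-M\odot\Sigma\|\le\varepsilon\|\Sigma\|\bigr\}\ge 0.99 .$$ In particular, for each fixed $\varepsilon$, $n=O(B\log^2p)$ samples suffice for a relative spectral-norm fluctuation at most $\varepsilon$. -/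

import Mathlib

open MeasureTheory ProbabilityTheory
open scoped Matrix
-- The norm `‖A‖` of a matrix is its spectral norm, that is, its `ℓ₂ → ℓ₂` operator norm.
open scoped Matrix.Norms.L2Operator

namespace MaskedCov

noncomputable section

/-- The matrix `E (x x*)` of a random vector `x`; it is the covariance matrix when `x` has
mean zero. -/
def covMatrix {Ω : Type*} [MeasurableSpace Ω] {p : ℕ} (P : Measure Ω)
    (x : Ω → EuclideanSpace ℝ (Fin p)) : Matrix (Fin p) (Fin p) ℝ :=
  Matrix.of fun i j => ∫ ω, x ω i * x ω j ∂P

/-- The sample covariance matrix `(1/n) ∑ᵢ xᵢ xᵢ*` of the samples `X 0, …, X (n - 1)`,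
at the outcome `ω`. -/
def sampleCov {Ω : Type*} {p n : ℕ} (X : Fin n → Ω → EuclideanSpace ℝ (Fin p)) (ω : Ω) :
    Matrix (Fin p) (Fin p) ℝ :=
  (1 / (n : ℝ)) • ∑ i, Matrix.vecMulVec (X i ω).ofLp (X i ω).ofLp

/-- The fluctuation `M ⊙ Σ̂ₙ - M ⊙ Σ` of the masked sample covariance estimator. -/
def fluctuation {Ω : Type*} [MeasurableSpace Ω] {p n : ℕ} (P : Measure Ω)
    (x : Ω → EuclideanSpace ℝ (Fin p)) (X : Fin n → Ω → EuclideanSpace ℝ (Fin p))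
    (M : Matrix (Fin p) (Fin p) ℝ) (ω : Ω) : Matrix (Fin p) (Fin p) ℝ :=
  M ⊙ sampleCov X ω - M ⊙ covMatrix P x

/-- The root-mean-square spectral norm of the fluctuation. -/
def rmsFluctuation {Ω : Type*} [MeasurableSpace Ω] {p n : ℕ} (P : Measure Ω)
    (x : Ω → EuclideanSpace ℝ (Fin p)) (X : Fin n → Ω → EuclideanSpace ℝ (Fin p))
    (M : Matrix (Fin p) (Fin p) ℝ) : ℝ :=
  √(∫ ω, ‖fluctuation P x X M ω‖ ^ 2 ∂P)

/-- The maximum absolute entry of a matrix. -/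
def maxNorm {p : ℕ} (A : Matrix (Fin p) (Fin p) ℝ) : ℝ :=
  ⨆ ij : Fin p × Fin p, |A ij.1 ij.2|

/-- The maximum `ℓ₂` norm of a column of a matrix. -/
def colNorm {p : ℕ} (A : Matrix (Fin p) (Fin p) ℝ) : ℝ :=
  ⨆ j : Fin p, √(∑ i, A i j ^ 2)

/-- A symmetric 0-1 matrix supported on the band `|i - j| ≤ b`, of bandwidth `2 b + 1`. -/
structure IsBandedMask {p : ℕ} (b : ℕ) (M : Matrix (Fin p) (Fin p) ℝ) : Prop where
  symm : M.IsSymm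
  zero_or_one : ∀ i j, M i j = 0 ∨ M i j = 1
  band : ∀ i j : Fin p, (b : ℤ) < |(i : ℤ) - (j : ℤ)| → M i j = 0

end

end MaskedCov

/-! The fluctuation is 1/n times a centred sum of independent copies of the symmetric matrix S = M ⊙
xx*. With L = log p, a matrix Rosenthal inequality (`integral_norm_centered_sum_sq_le`) bounds the
mean square norm of such a sum by a constant times L n ‖E S²‖ + L² E ρ, where ρ is any envelope of
max ‖S_i‖².

That inequality comes from symmetrization and the noncommutative Khintchine inequality
(`sum_norm_signedSum_sq_le`), which together leave L E‖∑ S_i²‖. A second round, applied to the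
matrices S_i², bounds this quantity in terms of itself, with a coefficient 1/2 that is absorbed.
Khintchine is proved by trace moments: flipping one sign at a time plays the role of integration by
parts on the cube and lowers the power by two.

The Gaussian law enters through two estimates. Rowwise fourth moments give ‖E S²‖ ≤ 64 ‖Σ‖_max ‖Σ‖
‖M‖²_{1→2} (`norm_integral_maskedOuter_sq_le`). The factorization S = D M D, with D the diagonal
matrix of x, gives ‖S‖ ≤ ‖M‖ max x_i², and exponential moments of x_i² make the maximum over all np
coordinates cost only log(np).

For a banded mask, ‖M‖ and ‖M‖²_{1→2} are both at most min(B, p). The factor log(np) is then removed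
(`relative_error_le`): for n ≤ p³ it is comparable to log p, and for larger n a power of n dominates
it. Markov's inequality gives the probability bound. -/

namespace MaskedCov

/-! ### Spectral norm estimates and the noncommutative Khintchine inequality -/

section Deterministic

theorem norm_toLp_sq {d : Type*} [Fintype d] (u : d → ℝ) : ‖WithLp.toLp 2 u‖ ^ 2 = u ⬝ᵥ u := by
  rw [EuclideanSpace.real_norm_sq_eq]
  simp [dotProduct, sq]

variable {d : Type*} [Fintype d] [DecidableEq d]

theorem mulVec_dotProduct_self_le (A : Matrix d d ℝ) (u : d → ℝ) :
    (A *ᵥ u) ⬝ᵥ (A *ᵥ u) ≤ ‖A‖ ^ 2 * (u ⬝ᵥ u) := by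
  have h := Matrix.l2_opNorm_mulVec A (WithLp.toLp 2 u)
  have h' : ‖WithLp.toLp 2 (A *ᵥ u)‖ ≤ ‖A‖ * ‖WithLp.toLp 2 u‖ := h
  rw [← norm_toLp_sq, ← norm_toLp_sq, ← mul_pow]
  gcongr

theorem norm_le_of_mulVec {A : Matrix d d ℝ} {c : ℝ} (hc : 0 ≤ c)
    (h : ∀ u, (A *ᵥ u) ⬝ᵥ (A *ᵥ u) ≤ c ^ 2 * (u ⬝ᵥ u)) : ‖A‖ ≤ c := by
  rw [Matrix.cstar_norm_def]
  refine ContinuousLinearMap.opNorm_le_bound _ hc fun x => ?_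
  have h1 := h x.ofLp
  rw [← norm_toLp_sq, ← norm_toLp_sq, ← mul_pow] at h1
  exact le_of_sq_le_sq h1 (by positivity)

theorem abs_dotProduct_mulVec_le (A : Matrix d d ℝ) (u w : d → ℝ) :
    |w ⬝ᵥ A *ᵥ u| ≤ ‖A‖ * (‖WithLp.toLp 2 w‖ * ‖WithLp.toLp 2 u‖) := by
  have h := Matrix.l2_opNorm_mulVec A (WithLp.toLp 2 u)
  have h' : ‖WithLp.toLp 2 (A *ᵥ u)‖ ≤ ‖A‖ * ‖WithLp.toLp 2 u‖ := h
  have h2 := abs_real_inner_le_norm (WithLp.toLp 2 w) (WithLp.toLp 2 (A *ᵥ u))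
  have h3 : inner ℝ (WithLp.toLp 2 w) (WithLp.toLp 2 (A *ᵥ u)) = w ⬝ᵥ A *ᵥ u := by
    simp [PiLp.inner_apply, dotProduct, mul_comm]
  rw [h3] at h2
  calc _ ≤ _ := h2
    _ ≤ ‖WithLp.toLp 2 w‖ * (‖A‖ * ‖WithLp.toLp 2 u‖) := by gcongr
    _ = _ := by ring

theorem dotProduct_mulVec_le (A : Matrix d d ℝ) (u : d → ℝ) :
    u ⬝ᵥ A *ᵥ u ≤ ‖A‖ * (u ⬝ᵥ u) := by
  refine (le_abs_self _).trans ((abs_dotProduct_mulVec_le A u u).trans_eq ?_)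
  rw [← norm_toLp_sq, sq]

open scoped MatrixOrder in
-- Factor A = B*B: the quadratic form of A is |Bu|², and the C*-identity turns a bound on ‖B‖ into
-- one on ‖A‖.
theorem norm_le_of_posSemidef {A : Matrix d d ℝ} (hA : A.PosSemidef) {c : ℝ} (hc : 0 ≤ c)
    (h : ∀ u, u ⬝ᵥ A *ᵥ u ≤ c * (u ⬝ᵥ u)) : ‖A‖ ≤ c := by
  obtain ⟨B, rfl⟩ := CStarAlgebra.nonneg_iff_eq_star_mul_self.mp hA.nonneg
  rw [Matrix.star_eq_conjTranspose] at h ⊢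
  rw [Matrix.l2_opNorm_conjTranspose_mul_self, ← sq, ← Real.sq_sqrt hc]
  gcongr
  refine norm_le_of_mulVec (Real.sqrt_nonneg c) fun u => ?_
  rw [Real.sq_sqrt hc]
  refine le_trans (le_of_eq ?_) (h u)
  rw [← Matrix.mulVec_mulVec, Matrix.conjTranspose_eq_transpose_of_trivial,
    Matrix.dotProduct_mulVec u, Matrix.vecMul_transpose]

theorem norm_sq_le_trace {A : Matrix d d ℝ} (hA : A.IsSymm) : ‖A‖ ^ 2 ≤ (A * A).trace := by
  have h0 : 0 ≤ (A * A).trace := by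
    have := (Matrix.posSemidef_conjTranspose_mul_self A).trace_nonneg
    rwa [Matrix.conjTranspose_eq_transpose_of_trivial, hA.eq] at this
  rw [← Real.sq_sqrt h0]
  gcongr
  refine norm_le_of_mulVec (Real.sqrt_nonneg _) fun u => ?_
  rw [Real.sq_sqrt h0]
  simp only [dotProduct, Matrix.mulVec, Matrix.trace, Matrix.diag, Matrix.mul_apply]
  rw [Finset.sum_mul]
  refine Finset.sum_le_sum fun i _ => ?_
  have := Finset.sum_mul_sq_le_sq_mul_sq Finset.univ (fun j => A i j) u
  simp only [sq] at this
  refine this.trans_eq ?_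
  congr 1
  exact Finset.sum_congr rfl fun j _ => by rw [hA.apply]

/-- Pair q with r - q: since |a|^q - |b|^q and |a|^(r-q) - |b|^(r-q) have the same sign, each pair
is at most |a|^r + |b|^r. Evenness of r removes the absolute values. -/
theorem sum_pow_mul_pow_le (a b : ℝ) {r : ℕ} (hr : Even r) :
    ∑ q ∈ Finset.range (r + 1), a ^ q * b ^ (r - q) ≤ (r + 1) / 2 * (a ^ r + b ^ r) := by
  have key : ∀ q ∈ Finset.range (r + 1),
      a ^ q * b ^ (r - q) + a ^ (r - q) * b ^ q ≤ a ^ r + b ^ r := by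
    intro q hq
    have hq : q ≤ r := Nat.lt_succ_iff.1 (Finset.mem_range.1 hq)
    obtain ⟨s, rfl⟩ := Nat.exists_eq_add_of_le hq
    rw [Nat.add_sub_cancel_left]
    have h1 : a ^ q * b ^ s + a ^ s * b ^ q ≤ |a| ^ q * |b| ^ s + |a| ^ s * |b| ^ q := by
      simp only [← abs_pow, ← abs_mul]
      exact add_le_add (le_abs_self _) (le_abs_self _)
    have h2 : 0 ≤ (|a| ^ q - |b| ^ q) * (|a| ^ s - |b| ^ s) := by
      rcases le_total |a| |b| with h | h
      · exact mul_nonneg_of_nonpos_of_nonpos (sub_nonpos.2 (by gcongr)) (sub_nonpos.2 (by gcongr))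
      · exact mul_nonneg (sub_nonneg.2 (by gcongr)) (sub_nonneg.2 (by gcongr))
    have h3 : |a| ^ (q + s) = a ^ (q + s) := hr.pow_abs a
    have h4 : |b| ^ (q + s) = b ^ (q + s) := hr.pow_abs b
    rw [pow_add] at h3 h4
    nlinarith
  have h1 := Finset.sum_le_sum key
  rw [Finset.sum_add_distrib] at h1
  have h2 : ∑ q ∈ Finset.range (r + 1), a ^ (r - q) * b ^ q
      = ∑ q ∈ Finset.range (r + 1), a ^ q * b ^ (r - q) := by
    rw [← Finset.sum_range_reflect]
    refine Finset.sum_congr rfl fun q hq => ?_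
    have hq : q ≤ r := Nat.lt_succ_iff.1 (Finset.mem_range.1 hq)
    congr 2; omega
  rw [h2] at h1
  simp at h1
  linarith

/-- Diagonalize W = U diag(a) Uᵀ and Y = V diag(b) Vᵀ, and take G = Uᵀ H V. The weights G j k ^ 2
are nonnegative and do not depend on the exponents, so scalar inequalities in a and b pass to
traces. -/
theorem exists_trace_mul_pow_mul_pow {H W Y : Matrix d d ℝ} (hH : H.IsSymm) (hW : W.IsSymm)
    (hY : Y.IsSymm) : ∃ (G : Matrix d d ℝ) (a b : d → ℝ), ∀ q s : ℕ,
      (H * W ^ q * H * Y ^ s).trace = ∑ j, ∑ k, G j k ^ 2 * (a j ^ q * b k ^ s) := by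
  have diag : ∀ {A : Matrix d d ℝ}, A.IsSymm → ∃ (U : Matrix d d ℝ) (a : d → ℝ),
      ∀ q : ℕ, A ^ q = U * Matrix.diagonal (fun j => a j ^ q) * Uᵀ := by
    intro A hA
    have hA' : A.IsHermitian := by
      rw [Matrix.IsHermitian, Matrix.conjTranspose_eq_transpose_of_trivial, hA.eq]
    refine ⟨hA'.eigenvectorUnitary, hA'.eigenvalues, fun q => ?_⟩
    have h1 := hA'.spectral_theorem
    have hU : (hA'.eigenvectorUnitary : Matrix d d ℝ)ᵀ
        * (hA'.eigenvectorUnitary : Matrix d d ℝ) = 1 := by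
      have := Unitary.coe_star_mul_self hA'.eigenvectorUnitary
      rwa [Matrix.star_eq_conjTranspose, Matrix.conjTranspose_eq_transpose_of_trivial] at this
    have hU' : (hA'.eigenvectorUnitary : Matrix d d ℝ)
        * (hA'.eigenvectorUnitary : Matrix d d ℝ)ᵀ = 1 := mul_eq_one_comm.1 hU
    have h2 : A = (hA'.eigenvectorUnitary : Matrix d d ℝ) * Matrix.diagonal hA'.eigenvalues
        * (hA'.eigenvectorUnitary : Matrix d d ℝ)ᵀ := by
      conv_lhs => rw [h1]
      rw [Unitary.conjStarAlgAut_apply]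
      rfl
    induction q with
    | zero => simp [hU']
    | succ q ih =>
      rw [pow_succ, ih]
      conv_lhs => enter [2]; rw [h2]
      calc _ = (hA'.eigenvectorUnitary : Matrix d d ℝ)
            * Matrix.diagonal (fun j => hA'.eigenvalues j ^ q)
            * ((hA'.eigenvectorUnitary : Matrix d d ℝ)ᵀ
              * (hA'.eigenvectorUnitary : Matrix d d ℝ)) * Matrix.diagonal hA'.eigenvalues
            * (hA'.eigenvectorUnitary : Matrix d d ℝ)ᵀ := by noncomm_ring
        _ = _ := by
          rw [hU, mul_one, mul_assoc (hA'.eigenvectorUnitary : Matrix d d ℝ) (Matrix.diagonal _)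
            (Matrix.diagonal _), Matrix.diagonal_mul_diagonal]
          simp only [pow_succ]
  obtain ⟨U, a, hU⟩ := diag hW
  obtain ⟨V, b, hV⟩ := diag hY
  refine ⟨Uᵀ * H * V, a, b, fun q s => ?_⟩
  rw [hU q, hV s]
  have hGt : (Uᵀ * H * V)ᵀ = Vᵀ * H * U := by
    simp [Matrix.transpose_mul, hH.eq, Matrix.mul_assoc]
  calc (H * (U * Matrix.diagonal (fun j => a j ^ q) * Uᵀ) * H
        * (V * Matrix.diagonal (fun j => b j ^ s) * Vᵀ)).trace
      = ((H * U * Matrix.diagonal (fun j => a j ^ q) * Uᵀ * H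
        * V * Matrix.diagonal (fun j => b j ^ s)) * Vᵀ).trace := by
          simp only [Matrix.mul_assoc]
    _ = ((Uᵀ * H * V)ᵀ * Matrix.diagonal (fun j => a j ^ q) * (Uᵀ * H * V)
        * Matrix.diagonal (fun j => b j ^ s)).trace := by
          rw [Matrix.trace_mul_comm, hGt]
          simp only [Matrix.mul_assoc]
    _ = _ := by
      generalize Uᵀ * H * V = G
      simp only [Matrix.trace, Matrix.diag, Matrix.mul_diagonal]
      rw [Finset.sum_comm]
      refine Finset.sum_congr rfl fun k _ => ?_
      rw [Matrix.mul_apply, Finset.sum_mul]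
      refine Finset.sum_congr rfl fun j _ => ?_
      rw [Matrix.mul_diagonal, Matrix.transpose_apply]
      ring

theorem sum_trace_mul_pow_mul_pow_le {H W Y : Matrix d d ℝ} (hH : H.IsSymm) (hW : W.IsSymm)
    (hY : Y.IsSymm) {r : ℕ} (hr : Even r) :
    ∑ q ∈ Finset.range (r + 1), (H * W ^ q * H * Y ^ (r - q)).trace
      ≤ (r + 1) / 2 * ((H * H * W ^ r).trace + (H * H * Y ^ r).trace) := by
  obtain ⟨G, a, b, h⟩ := exists_trace_mul_pow_mul_pow hH hW hY
  have h1 : (H * H * W ^ r).trace = ∑ j, ∑ k, G j k ^ 2 * a j ^ r := by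
    have := h r 0
    simp only [pow_zero, mul_one] at this
    rw [← this, Matrix.trace_mul_comm (H * W ^ r), ← mul_assoc]
  have h2 : (H * H * Y ^ r).trace = ∑ j, ∑ k, G j k ^ 2 * b k ^ r := by
    have := h 0 r
    simpa only [pow_zero, mul_one, one_mul] using this
  rw [h1, h2, Finset.sum_congr rfl fun q _ => h q (r - q), Finset.sum_comm,
    ← Finset.sum_add_distrib, Finset.mul_sum]
  refine Finset.sum_le_sum fun j _ => ?_
  rw [Finset.sum_comm, ← Finset.sum_add_distrib, Finset.mul_sum]
  refine Finset.sum_le_sum fun k _ => ?_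
  rw [← Finset.mul_sum]
  have := mul_le_mul_of_nonneg_left (sum_pow_mul_pow_le (a j) (b k) hr) (sq_nonneg (G j k))
  linarith

theorem pow_succ_sub_pow_succ {R : Type*} [Ring R] (W Y : R) (m : ℕ) :
    W ^ (m + 1) - Y ^ (m + 1)
      = ∑ q ∈ Finset.range (m + 1), W ^ q * (W - Y) * Y ^ (m - q) := by
  induction m with
  | zero => simp
  | succ m ih =>
    rw [Finset.sum_range_succ, Nat.sub_self, pow_zero, mul_one]
    have : ∑ q ∈ Finset.range (m + 1), W ^ q * (W - Y) * Y ^ (m + 1 - q)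
        = (W ^ (m + 1) - Y ^ (m + 1)) * Y := by
      rw [ih, Finset.sum_mul]
      refine Finset.sum_congr rfl fun q hq => ?_
      have hq : q ≤ m := Nat.lt_succ_iff.1 (Finset.mem_range.1 hq)
      rw [Nat.succ_sub hq, pow_succ]
      simp only [mul_assoc]
    rw [this, pow_succ W (m + 1), pow_succ Y (m + 1)]
    noncomm_ring

/-- The sum of the vectors `H i` with the signs `e i`. -/
noncomputable def signedSum {ι F : Type*} [Fintype ι] [AddCommGroup F] [Module ℝ F] (H : ι → F)
    (e : ι → ℤˣ) : F :=
  ∑ i, ((e i : ℤ) : ℝ) • H i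

variable {ι : Type*} [Fintype ι] [DecidableEq ι]

theorem isSymm_signedSum {ι d : Type*} [Fintype ι]
    {H : ι → Matrix d d ℝ} (hH : ∀ i, (H i).IsSymm) (e : ι → ℤˣ) :
    (signedSum H e).IsSymm := by
  unfold signedSum
  rw [Matrix.IsSymm, Matrix.transpose_sum]
  exact Finset.sum_congr rfl fun i _ => by rw [Matrix.transpose_smul, (hH i).eq]

theorem signedSum_sub_flip {F : Type*} [AddCommGroup F] [Module ℝ F] (H : ι → F) (e : ι → ℤˣ)
    (i : ι) : signedSum H e - signedSum H (Pi.mulSingle i (-1) * e)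
      = (2 * ((e i : ℤ) : ℝ)) • H i := by
  unfold signedSum
  rw [← Finset.sum_sub_distrib, Finset.sum_eq_single i]
  · simp only [Pi.mul_apply, Pi.mulSingle_eq_same, neg_mul, one_mul, Units.val_neg, Int.cast_neg]
    rw [← sub_smul]
    congr 1
    ring
  · intro j _ hj
    simp [Pi.mulSingle_eq_of_ne hj]
  · simp

/-- Flipping the i-th sign is a bijection of the cube that negates e i; averaging the sum with its
image gives a discrete integration by parts. -/
theorem sum_sign_mul_eq (i : ι) (g : (ι → ℤˣ) → ℝ) :
    ∑ e : ι → ℤˣ, ((e i : ℤ) : ℝ) * g e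
      = 1 / 2 * ∑ e : ι → ℤˣ, ((e i : ℤ) : ℝ) * (g e - g (Pi.mulSingle i (-1) * e)) := by
  have h := Equiv.sum_comp (Equiv.mulLeft (Pi.mulSingle i (-1) : ι → ℤˣ))
    (fun e => ((e i : ℤ) : ℝ) * g e)
  simp only [Equiv.coe_mulLeft, Pi.mul_apply, Pi.mulSingle_eq_same, neg_mul, one_mul,
    Units.val_neg, Int.cast_neg, Finset.sum_neg_distrib] at h
  simp only [mul_sub, Finset.sum_sub_distrib]
  linarith

theorem sum_comp_flip (i : ι) (g : (ι → ℤˣ) → ℝ) :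
    ∑ e : ι → ℤˣ, g (Pi.mulSingle i (-1) * e) = ∑ e, g e :=
  Equiv.sum_comp (Equiv.mulLeft (Pi.mulSingle i (-1) : ι → ℤˣ)) g

theorem sq_sign (u : ℤˣ) : ((u : ℤ) : ℝ) * ((u : ℤ) : ℝ) = 1 := by
  rcases Int.units_eq_one_or u with rfl | rfl <;> simp

theorem isSymm_pow {A : Matrix d d ℝ} (hA : A.IsSymm) (k : ℕ) : (A ^ k).IsSymm := by
  rw [Matrix.IsSymm, Matrix.transpose_pow, hA.eq]

theorem posSemidef_mul_self {d : Type*} [Fintype d] {A : Matrix d d ℝ} (hA : A.IsSymm) :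
    (A * A).PosSemidef := by
  have := Matrix.posSemidef_conjTranspose_mul_self A
  rwa [Matrix.conjTranspose_eq_transpose_of_trivial, hA.eq] at this

/-- The matrix ‖V‖ I - V is positive semidefinite, hence so is its conjugate by A, whose trace is
nonnegative. -/
theorem trace_mul_le_norm_mul_trace {V A : Matrix d d ℝ} (hV : V.IsSymm) (hA : A.IsSymm) :
    (V * (A * A)).trace ≤ ‖V‖ * (A * A).trace := by
  have h : (‖V‖ • (1 : Matrix d d ℝ) - V).PosSemidef := by
    refine .of_dotProduct_mulVec_nonneg ?_ fun u => ?_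
    · rw [Matrix.IsHermitian, Matrix.conjTranspose_eq_transpose_of_trivial]
      simp [hV.eq]
    · rw [star_trivial, Matrix.sub_mulVec, Matrix.smul_mulVec, Matrix.one_mulVec, dotProduct_sub,
        dotProduct_smul, smul_eq_mul, sub_nonneg]
      exact dotProduct_mulVec_le V u
  have h2 := (h.conjTranspose_mul_mul_same A).trace_nonneg
  rw [Matrix.conjTranspose_eq_transpose_of_trivial, hA.eq] at h2
  have h3 : A * (‖V‖ • (1 : Matrix d d ℝ) - V) * A = ‖V‖ • (A * A) - A * V * A := by
    rw [mul_sub, sub_mul]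
    simp
  rw [h3, Matrix.trace_sub, Matrix.trace_smul, smul_eq_mul, mul_assoc,
    Matrix.trace_mul_comm A (V * A), Matrix.mul_assoc] at h2
  linarith

/-- Split one factor of the power into its terms e i • H i and antisymmetrize in e i. The difference
of the two odd powers telescopes around S - S' = 2 e i H i, the signs cancel, and the trace
inequality above restores H i * H i next to an even power. Summing over i produces the variance ∑ H
i * H i. -/
theorem sum_trace_signedSum_pow_succ_le {H : ι → Matrix d d ℝ} (hH : ∀ i, (H i).IsSymm) (m : ℕ) :
    ∑ e, (signedSum H e ^ (2 * (m + 1))).trace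
      ≤ (2 * m + 1) * ‖∑ i, H i * H i‖ * ∑ e, (signedSum H e ^ (2 * m)).trace := by
  have hS := isSymm_signedSum hH
  have h1 : ∀ e, (signedSum H e ^ (2 * (m + 1))).trace
      = ∑ i, ((e i : ℤ) : ℝ) * (H i * signedSum H e ^ (2 * m + 1)).trace := by
    intro e
    rw [show 2 * (m + 1) = 2 * m + 1 + 1 by ring, pow_succ']
    conv_lhs => enter [1, 1]; rw [signedSum]
    rw [Finset.sum_mul, Matrix.trace_sum]
    exact Finset.sum_congr rfl fun i _ => by rw [smul_mul_assoc, Matrix.trace_smul, smul_eq_mul]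
  have h2 : ∀ i, ∑ e, ((e i : ℤ) : ℝ) * (H i * signedSum H e ^ (2 * m + 1)).trace
      ≤ (2 * m + 1) * ∑ e, (H i * H i * signedSum H e ^ (2 * m)).trace := by
    intro i
    rw [sum_sign_mul_eq]
    have h3 : ∀ e : ι → ℤˣ, ((e i : ℤ) : ℝ) * ((H i * signedSum H e ^ (2 * m + 1)).trace
        - (H i * signedSum H (Pi.mulSingle i (-1) * e) ^ (2 * m + 1)).trace)
        ≤ (2 * m + 1) * ((H i * H i * signedSum H e ^ (2 * m)).trace
          + (H i * H i * signedSum H (Pi.mulSingle i (-1) * e) ^ (2 * m)).trace) := by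
      intro e
      have h4 := sum_trace_mul_pow_mul_pow_le (hH i) (hS e) (hS (Pi.mulSingle i (-1) * e))
        (even_two_mul m)
      have h5 : ((e i : ℤ) : ℝ) * ((H i * signedSum H e ^ (2 * m + 1)).trace
          - (H i * signedSum H (Pi.mulSingle i (-1) * e) ^ (2 * m + 1)).trace)
          = 2 * ∑ q ∈ Finset.range (2 * m + 1), (H i * signedSum H e ^ q * H i
            * signedSum H (Pi.mulSingle i (-1) * e) ^ (2 * m - q)).trace := by
        rw [← Matrix.trace_sub, ← mul_sub, pow_succ_sub_pow_succ, signedSum_sub_flip,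
          Finset.mul_sum, Matrix.trace_sum, Finset.mul_sum, Finset.mul_sum]
        refine Finset.sum_congr rfl fun q _ => ?_
        rw [mul_smul_comm, smul_mul_assoc, mul_smul_comm, Matrix.trace_smul, smul_eq_mul,
          ← mul_assoc, ← mul_assoc, ← mul_assoc, ← mul_assoc,
          show ((e i : ℤ) : ℝ) * 2 * ((e i : ℤ) : ℝ) = 2 * (((e i : ℤ) : ℝ) * ((e i : ℤ) : ℝ)) by
            ring, sq_sign, mul_one]
      rw [h5]
      push_cast at h4
      linarith
    have h6 := Finset.sum_le_sum fun e (_ : e ∈ Finset.univ) => h3 e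
    rw [← Finset.mul_sum, Finset.sum_add_distrib,
      sum_comp_flip i fun e => (H i * H i * signedSum H e ^ (2 * m)).trace] at h6
    linarith
  have hV : (∑ i, H i * H i).IsSymm := by
    rw [Matrix.IsSymm, Matrix.transpose_sum]
    exact Finset.sum_congr rfl fun i _ => by rw [Matrix.transpose_mul, (hH i).eq]
  have h7 : ∀ e, ((∑ i, H i * H i) * signedSum H e ^ (2 * m)).trace
      ≤ ‖∑ i, H i * H i‖ * (signedSum H e ^ (2 * m)).trace := by
    intro e
    rw [two_mul m, pow_add]
    exact trace_mul_le_norm_mul_trace hV (isSymm_pow (hS e) m)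
  calc ∑ e, (signedSum H e ^ (2 * (m + 1))).trace
      = ∑ i, ∑ e, ((e i : ℤ) : ℝ) * (H i * signedSum H e ^ (2 * m + 1)).trace := by
        rw [Finset.sum_comm]
        exact Finset.sum_congr rfl fun e _ => h1 e
    _ ≤ ∑ i, (2 * m + 1) * ∑ e, (H i * H i * signedSum H e ^ (2 * m)).trace :=
        Finset.sum_le_sum fun i _ => h2 i
    _ = (2 * m + 1) * ∑ e, ((∑ i, H i * H i) * signedSum H e ^ (2 * m)).trace := by
        rw [← Finset.mul_sum, Finset.sum_comm]
        congr 1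
        exact Finset.sum_congr rfl fun e _ => by rw [Finset.sum_mul, Matrix.trace_sum]
    _ ≤ (2 * m + 1) * ∑ e, ‖∑ i, H i * H i‖ * (signedSum H e ^ (2 * m)).trace := by
        gcongr with e
        exact h7 e
    _ = _ := by rw [← Finset.mul_sum]; ring

theorem sum_trace_signedSum_pow_le {H : ι → Matrix d d ℝ} (hH : ∀ i, (H i).IsSymm) (m : ℕ) :
    ∑ e, (signedSum H e ^ (2 * m)).trace
      ≤ (2 * m * ‖∑ i, H i * H i‖) ^ m * (Fintype.card (ι → ℤˣ) * Fintype.card d) := by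
  induction m with
  | zero => simp
  | succ m ih =>
    refine (sum_trace_signedSum_pow_succ_le hH m).trans ?_
    set v := ‖∑ i, H i * H i‖
    have hv : 0 ≤ v := norm_nonneg _
    calc (2 * m + 1) * v * ∑ e, (signedSum H e ^ (2 * m)).trace
        ≤ (2 * m + 1) * v
          * ((2 * m * v) ^ m * (Fintype.card (ι → ℤˣ) * Fintype.card d)) := by gcongr
      _ ≤ (2 * (m + 1) * v)
          * ((2 * (m + 1) * v) ^ m * (Fintype.card (ι → ℤˣ) * Fintype.card d)) := by
          gcongr <;> linarith
      _ = _ := by push_cast; ring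

/-- The noncommutative Khintchine inequality for the spectral norm, in mean square. -/
theorem sum_norm_signedSum_sq_le {H : ι → Matrix d d ℝ} (hH : ∀ i, (H i).IsSymm)
    (hd : 3 ≤ Fintype.card d) :
    ∑ e, ‖signedSum H e‖ ^ 2
      ≤ Fintype.card (ι → ℤˣ) * (11 * Real.log (Fintype.card d) * ‖∑ i, H i * H i‖) := by
  set L := Real.log (Fintype.card d)
  set v := ‖∑ i, H i * H i‖
  set N : ℝ := (Fintype.card (ι → ℤˣ) : ℝ)
  have hv : 0 ≤ v := norm_nonneg _
  have hN : 0 < N := by simp only [N]; exact_mod_cast Fintype.card_pos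
  have hd' : (3 : ℝ) ≤ Fintype.card d := by exact_mod_cast hd
  have hL : 1 < L := by
    rw [Real.lt_log_iff_exp_lt (by linarith)]
    linarith [Real.exp_one_lt_d9]
  -- The moment order m is a power of two with L ≤ m ≤ 2L. The lower bound gives d ≤ exp m, so the
  -- dimension costs only a constant after the m-th root; being a power of two makes ‖S^m‖ = ‖S‖^m
  -- by iterating the C*-identity.
  obtain ⟨k, hk1, hk2⟩ := exists_nat_pow_near hL.le one_lt_two
  set m : ℕ := 2 ^ (k + 1) with hm
  have hmL : L ≤ m := by rw [hm]; push_cast; exact hk2.le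
  have hm2 : (m : ℝ) ≤ 2 * L := by rw [hm]; push_cast; rw [pow_succ]; linarith
  have hm0 : m ≠ 0 := by simp [hm]
  have hnorm : ∀ e, (‖signedSum H e‖ ^ 2) ^ m ≤ (signedSum H e ^ (2 * m)).trace := by
    intro e
    have hS := isSymm_signedSum hH e
    have h1 : IsSelfAdjoint (signedSum H e) := by
      rw [IsSelfAdjoint, Matrix.star_eq_conjTranspose,
        Matrix.conjTranspose_eq_transpose_of_trivial, hS.eq]
    have h2 : ‖signedSum H e ^ m‖ = ‖signedSum H e‖ ^ m :=
      congrArg NNReal.toReal (h1.nnnorm_pow_two_pow (k + 1))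
    rw [← pow_mul, mul_comm 2 m, pow_mul, ← h2, mul_two, pow_add]
    exact norm_sq_le_trace (isSymm_pow hS m)
  have hjensen := Real.pow_arith_mean_le_arith_mean_pow Finset.univ (fun _ : ι → ℤˣ => N⁻¹)
    (fun e => ‖signedSum H e‖ ^ 2) (fun _ _ => by positivity)
    (by rw [Finset.sum_const, nsmul_eq_mul]; exact mul_inv_cancel₀ hN.ne')
    (fun _ _ => by positivity) m
  rw [← Finset.mul_sum, ← Finset.mul_sum] at hjensen
  have h3 : N⁻¹ * ∑ e, (‖signedSum H e‖ ^ 2) ^ m ≤ (2 * m * v) ^ m * Fintype.card d := by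
    rw [inv_mul_le_iff₀ hN]
    refine (Finset.sum_le_sum fun e _ => hnorm e).trans
      ((sum_trace_signedSum_pow_le hH m).trans_eq ?_)
    ring
  have h4 : (Fintype.card d : ℝ) ≤ Real.exp 1 ^ m := by
    rw [← Real.exp_nat_mul, mul_one, ← Real.exp_log (show (0 : ℝ) < Fintype.card d by linarith)]
    exact Real.exp_le_exp.2 hmL
  have h5 : (N⁻¹ * ∑ e, ‖signedSum H e‖ ^ 2) ^ m ≤ (2 * m * v * Real.exp 1) ^ m := by
    rw [mul_pow _ (Real.exp 1)]
    exact hjensen.trans (h3.trans (by gcongr))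
  have h6 := le_of_pow_le_pow_left₀ hm0 (by positivity) h5
  rw [inv_mul_le_iff₀ hN] at h6
  refine h6.trans (mul_le_mul_of_nonneg_left ?_ hN.le)
  have : Real.exp 1 ≤ 2.75 := by linarith [Real.exp_one_lt_d9]
  calc 2 * m * v * Real.exp 1 ≤ 2 * (2 * L) * v * 2.75 := by gcongr
    _ = _ := by ring

theorem posSemidef_sum_mul_self {ι d : Type*} [Fintype ι] [Fintype d]
    {H : ι → Matrix d d ℝ} (hH : ∀ i, (H i).IsSymm) :
    (∑ i, H i * H i).PosSemidef :=
  Matrix.posSemidef_sum _ fun i _ => posSemidef_mul_self (hH i)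

theorem dotProduct_mul_self_mulVec {d : Type*} [Fintype d]
    {A : Matrix d d ℝ} (hA : A.IsSymm) (u : d → ℝ) :
    u ⬝ᵥ (A * A) *ᵥ u = (A *ᵥ u) ⬝ᵥ (A *ᵥ u) := by
  rw [← Matrix.mulVec_mulVec, Matrix.dotProduct_mulVec, ← Matrix.mulVec_transpose, hA.eq]

/-- In the positive semidefinite order, H i ^ 4 ≤ ‖H i‖² H i ^ 2 ≤ R H i ^ 2. -/
theorem norm_sum_pow_four_le {ι d : Type*} [Fintype ι] [Fintype d] [DecidableEq d]
    {H : ι → Matrix d d ℝ} (hH : ∀ i, (H i).IsSymm) {R : ℝ}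
    (hR : ∀ i, ‖H i‖ ^ 2 ≤ R) (hR0 : 0 ≤ R) :
    ‖∑ i, (H i * H i) * (H i * H i)‖ ≤ R * ‖∑ i, H i * H i‖ := by
  have hHH : ∀ i, (H i * H i).IsSymm := fun i => by
    rw [Matrix.IsSymm, Matrix.transpose_mul, (hH i).eq]
  refine norm_le_of_posSemidef (posSemidef_sum_mul_self hHH) (by positivity) fun u => ?_
  have h := dotProduct_mulVec_le (∑ i, H i * H i) u
  rw [Matrix.sum_mulVec, dotProduct_sum] at h ⊢
  calc ∑ i, u ⬝ᵥ (H i * H i * (H i * H i)) *ᵥ u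
      ≤ ∑ i, R * (u ⬝ᵥ (H i * H i) *ᵥ u) := by
        refine Finset.sum_le_sum fun i _ => ?_
        rw [dotProduct_mul_self_mulVec (hHH i), dotProduct_mul_self_mulVec (hH i),
          ← Matrix.mulVec_mulVec]
        refine (mulVec_dotProduct_self_le _ _).trans ?_
        have : 0 ≤ (H i *ᵥ u) ⬝ᵥ (H i *ᵥ u) := by rw [← norm_toLp_sq]; positivity
        gcongr
        exact hR i
    _ ≤ R * (‖∑ i, H i * H i‖ * (u ⬝ᵥ u)) := by
        rw [← Finset.mul_sum]; gcongr
    _ = _ := by ring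

end Deterministic

/-! ### Symmetrization by an independent copy -/

section Symmetrization

theorem norm_integral_pow_le {Y F : Type*} [MeasurableSpace Y] [NormedAddCommGroup F]
    [NormedSpace ℝ F] {ρ : Measure Y} [IsProbabilityMeasure ρ] {q : ℕ} (hq : 1 ≤ q) {W : Y → F}
    (hW : MemLp W q ρ) : ‖∫ y, W y ∂ρ‖ ^ q ≤ ∫ y, ‖W y‖ ^ q ∂ρ := by
  calc ‖∫ y, W y ∂ρ‖ ^ q ≤ (∫ y, ‖W y‖ ∂ρ) ^ q := by
        gcongr
        exact norm_integral_le_integral_norm _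
    _ ≤ _ := (convexOn_pow q).map_integral_le (continuous_pow q).continuousOn isClosed_Ici
        (.of_forall fun y => norm_nonneg (W y))
        ((hW.integrable (by exact_mod_cast hq)).norm) (hW.integrable_norm_pow (by omega))

variable {𝒵 F ι : Type*} [MeasurableSpace 𝒵] [NormedAddCommGroup F] [NormedSpace ℝ F]
  [Fintype ι] {μ : Measure 𝒵} [IsProbabilityMeasure μ]

theorem memLp_signedSum {q : ℕ} {f : 𝒵 → F} (hf : MemLp f q μ) (e : ι → ℤˣ) :
    MemLp (fun z : ι → 𝒵 => signedSum (fun i => f (z i)) e) q (Measure.pi fun _ => μ) :=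
  memLp_finsetSum _ fun i _ =>
    (hf.comp_measurePreserving (measurePreserving_eval (fun _ : ι => μ) i)).const_smul _

/-- Exchanging the two components at the places where the sign is negative. -/
def signSwap (u : ℤˣ) : 𝒵 × 𝒵 → 𝒵 × 𝒵 := if u = 1 then id else Prod.swap

theorem measurePreserving_signSwap (u : ℤˣ) :
    MeasurePreserving (signSwap u) (μ.prod μ) (μ.prod μ) := by
  unfold signSwap
  split_ifs
  · exact .id _
  · exact Measure.measurePreserving_swap

theorem sub_signSwap {𝒵 F : Type*} [AddCommGroup F] [Module ℝ F] (f : 𝒵 → F) (u : ℤˣ) (w : 𝒵 × 𝒵) :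
    f (signSwap u w).1 - f (signSwap u w).2 = ((u : ℤ) : ℝ) • (f w.1 - f w.2) := by
  unfold signSwap
  rcases Int.units_eq_one_or u with rfl | rfl
  · simp
  · simp

/-- Exchanging z i with its copy wherever e i = -1 preserves the product law and multiplies the i-th
difference by e i. -/
theorem integral_norm_sum_sub_pow_eq {q : ℕ} {f : 𝒵 → F} (hf : MemLp f q μ)
    (e : ι → ℤˣ) :
    ∫ y : (ι → 𝒵) × (ι → 𝒵), ‖∑ i, (f (y.1 i) - f (y.2 i))‖ ^ q
        ∂(Measure.pi fun _ => μ).prod (Measure.pi fun _ => μ)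
      = ∫ y : (ι → 𝒵) × (ι → 𝒵), ‖signedSum (fun i => f (y.1 i)) e
          - signedSum (fun i => f (y.2 i)) e‖ ^ q
          ∂(Measure.pi fun _ => μ).prod (Measure.pi fun _ => μ) := by
  have hΦ := measurePreserving_arrowProdEquivProdArrow 𝒵 𝒵 ι (fun _ => μ) (fun _ => μ)
  rw [← hΦ.map_eq, integral_map_equiv, integral_map_equiv]
  have hS := measurePreserving_pi (fun _ : ι => μ.prod μ) (fun _ => μ.prod μ)
    fun i => measurePreserving_signSwap (μ := μ) (e i)
  have hm : AEStronglyMeasurable (fun w : ι → 𝒵 × 𝒵 => ‖∑ i, (f (w i).1 - f (w i).2)‖ ^ q)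
      (Measure.pi fun _ => μ.prod μ) := by
    refine (AEStronglyMeasurable.norm ?_).pow q
    refine Finset.aestronglyMeasurable_fun_sum _ fun i _ => ?_
    have hev := measurePreserving_eval (fun _ : ι => μ.prod μ) i
    exact (hf.1.comp_measurePreserving (measurePreserving_fst.comp hev)).sub
      (hf.1.comp_measurePreserving (measurePreserving_snd.comp hev))
  calc ∫ w : ι → 𝒵 × 𝒵, ‖∑ i, (f (w i).1 - f (w i).2)‖ ^ q ∂(Measure.pi fun _ => μ.prod μ)
      = ∫ w : ι → 𝒵 × 𝒵, ‖∑ i, (f (signSwap (e i) (w i)).1 - f (signSwap (e i) (w i)).2)‖ ^ q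
          ∂(Measure.pi fun _ => μ.prod μ) := by
        have := integral_map hS.measurable.aemeasurable (by rw [hS.map_eq]; exact hm)
        rwa [hS.map_eq] at this
    _ = _ := by
        refine integral_congr_ae (.of_forall fun w => ?_)
        simp only [sub_signSwap, signedSum, smul_sub, Finset.sum_sub_distrib]
        rfl

/-- Symmetrization of a centred sum of independent, identically distributed vectors. -/
theorem integral_norm_centered_sum_pow_le [CompleteSpace F] {q : ℕ} (hq : 1 ≤ q) {f : 𝒵 → F}
    (hf : MemLp f q μ) (e : ι → ℤˣ) :
    ∫ z : ι → 𝒵, ‖∑ i, (f (z i) - ∫ y, f y ∂μ)‖ ^ q ∂(Measure.pi fun _ => μ)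
      ≤ 2 ^ q * ∫ z : ι → 𝒵, ‖signedSum (fun i => f (z i)) e‖ ^ q ∂(Measure.pi fun _ => μ) := by
  set π : Measure (ι → 𝒵) := Measure.pi fun _ => μ
  have hq0 : q ≠ 0 := by omega
  have hfi : Integrable f μ := hf.integrable (by exact_mod_cast hq)
  have hev : ∀ i, MemLp (fun z : ι → 𝒵 => f (z i)) q π := fun i =>
    hf.comp_measurePreserving (measurePreserving_eval (fun _ : ι => μ) i)
  have hg : MemLp (fun y : (ι → 𝒵) × (ι → 𝒵) => ∑ i, (f (y.1 i) - f (y.2 i))) q (π.prod π) :=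
    memLp_finsetSum _ fun i _ =>
      ((hev i).comp_measurePreserving measurePreserving_fst).sub
        ((hev i).comp_measurePreserving measurePreserving_snd)
  have hc : MemLp (fun z : ι → 𝒵 => ∑ i, (f (z i) - ∫ y, f y ∂μ)) q π :=
    memLp_finsetSum _ fun i _ => (hev i).sub (memLp_const _)
  have hsec : ∀ z : ι → 𝒵, MemLp (fun z' : ι → 𝒵 => ∑ i, (f (z i) - f (z' i))) q π := fun z =>
    memLp_finsetSum _ fun i _ => (memLp_const _).sub (hev i)
  -- The centred sum is the average of the differences over the second copy, so Jensen moves the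
  -- norm inside that average.
  have hcent : ∀ z : ι → 𝒵, ∑ i, (f (z i) - ∫ y, f y ∂μ)
      = ∫ z' : ι → 𝒵, ∑ i, (f (z i) - f (z' i)) ∂π := by
    intro z
    have hi : ∀ i, Integrable (fun z' : ι → 𝒵 => f (z' i)) π := fun i =>
      (hev i).integrable (by exact_mod_cast hq)
    rw [integral_finsetSum (f := fun i (z' : ι → 𝒵) => f (z i) - f (z' i)) _
      fun i _ => (integrable_const _).sub (hi i)]
    refine Finset.sum_congr rfl fun i _ => ?_
    rw [integral_sub (integrable_const _) (hi i), integral_const, probReal_univ, one_smul,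
      integral_comp_eval (μ := fun _ : ι => μ) (i := i) hf.1]
  have hint := hg.integrable_norm_pow hq0
  have hs := memLp_signedSum hf e
  have hs1 := (hs.comp_measurePreserving (measurePreserving_fst (μ := π) (ν := π)))
  have hs2 := (hs.comp_measurePreserving (measurePreserving_snd (μ := π) (ν := π)))
  have hi1 : Integrable (fun y : (ι → 𝒵) × (ι → 𝒵) => ‖signedSum (fun i => f (y.1 i)) e‖ ^ q)
      (π.prod π) := hs1.integrable_norm_pow hq0
  have hi2 : Integrable (fun y : (ι → 𝒵) × (ι → 𝒵) => ‖signedSum (fun i => f (y.2 i)) e‖ ^ q)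
      (π.prod π) := hs2.integrable_norm_pow hq0
  calc ∫ z, ‖∑ i, (f (z i) - ∫ y, f y ∂μ)‖ ^ q ∂π
      ≤ ∫ z, ∫ z', ‖∑ i, (f (z i) - f (z' i))‖ ^ q ∂π ∂π := by
        refine integral_mono (hc.integrable_norm_pow hq0) hint.integral_prod_left fun z => ?_
        simp only [hcent z]
        exact norm_integral_pow_le hq (hsec z)
    _ = ∫ y, ‖∑ i, (f (y.1 i) - f (y.2 i))‖ ^ q ∂π.prod π :=
        (integral_prod _ hint).symm
    _ = ∫ y, ‖signedSum (fun i => f (y.1 i)) e - signedSum (fun i => f (y.2 i)) e‖ ^ q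
          ∂π.prod π := integral_norm_sum_sub_pow_eq hf e
    _ ≤ ∫ y, 2 ^ (q - 1) * (‖signedSum (fun i => f (y.1 i)) e‖ ^ q
          + ‖signedSum (fun i => f (y.2 i)) e‖ ^ q) ∂π.prod π := by
        refine integral_mono ((hs1.sub hs2).integrable_norm_pow hq0)
          ((hi1.add hi2).const_mul _) fun y => ?_
        refine le_trans ?_ (add_pow_le (norm_nonneg _) (norm_nonneg _) q)
        gcongr
        exact norm_sub_le _ _
    _ = 2 ^ q * ∫ z, ‖signedSum (fun i => f (z i)) e‖ ^ q ∂π := by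
        rw [integral_const_mul, integral_add hi1 hi2]
        have h1 := integral_fun_fst (μ := π) (ν := π)
          (fun z => ‖signedSum (fun i => f (z i)) e‖ ^ q)
        have h2 := integral_fun_snd (μ := π) (ν := π)
          (fun z => ‖signedSum (fun i => f (z i)) e‖ ^ q)
        rw [probReal_univ, one_smul] at h1 h2
        rw [h1, h2, ← two_mul, ← mul_assoc, ← pow_succ, Nat.sub_add_cancel hq]

end Symmetrization

/-! ### A Rosenthal inequality for random symmetric matrices -/

section MatrixMoment

variable {𝒵 d ι : Type*} [MeasurableSpace 𝒵] [Fintype d] [DecidableEq d] [Fintype ι]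
  {μ : Measure 𝒵} [IsProbabilityMeasure μ]

theorem memLp_one_mul_self {𝒵 d : Type*} [MeasurableSpace 𝒵] [Fintype d] [DecidableEq d]
    {μ : Measure 𝒵} {S : 𝒵 → Matrix d d ℝ} (hS : MemLp S 2 μ) :
    MemLp (fun z => S z * S z) 1 μ := by
  rw [memLp_one_iff_integrable]
  refine Integrable.mono' (hS.integrable_norm_pow two_ne_zero) (hS.1.mul hS.1)
    (.of_forall fun z => ?_)
  rw [sq]
  exact norm_mul_le _ _

theorem integral_norm_sum_mul_self_le {S : 𝒵 → Matrix d d ℝ} (hsymm : ∀ z, (S z).IsSymm)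
    (hS : MemLp S 2 μ) (hd : 3 ≤ Fintype.card d) {ρ : (ι → 𝒵) → ℝ}
    (hρ : Integrable ρ (Measure.pi fun _ => μ)) (hSρ : ∀ z i, ‖S (z i)‖ ^ 2 ≤ ρ z)
    (hρ0 : ∀ z, 0 ≤ ρ z) :
    ∫ z : ι → 𝒵, ‖∑ i, S (z i) * S (z i)‖ ∂(Measure.pi fun _ => μ)
      ≤ 2 * Fintype.card ι * ‖∫ y, S y * S y ∂μ‖
        + 44 * Real.log (Fintype.card d) * ∫ z, ρ z ∂(Measure.pi fun _ => μ) := by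
  classical
  set π : Measure (ι → 𝒵) := Measure.pi fun _ => μ
  set L := Real.log (Fintype.card d)
  set A := ∫ y, S y * S y ∂μ
  set N : ℝ := (Fintype.card (ι → ℤˣ) : ℝ)
  have hL : 0 ≤ L := Real.log_natCast_nonneg _
  have hN : 0 < N := by simp only [N]; exact_mod_cast Fintype.card_pos
  have hS2 : MemLp (fun z => S z * S z) (1 : ℕ) μ := by simpa using memLp_one_mul_self hS
  have hev : ∀ i, Integrable (fun z : ι → 𝒵 => S (z i) * S (z i)) π := fun i =>
    integrable_comp_eval (μ := fun _ : ι => μ) (i := i) (f := fun z => S z * S z)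
      (hS2.integrable (by simp))
  have hY : Integrable (fun z : ι → 𝒵 => ‖∑ i, S (z i) * S (z i)‖) π :=
    (integrable_finsetSum _ fun i _ => hev i).norm
  have hJ : Integrable (fun z : ι → 𝒵 => ‖∑ i, (S (z i) * S (z i) - A)‖) π :=
    (integrable_finsetSum (f := fun i (z : ι → 𝒵) => S (z i) * S (z i) - A) _
      fun i _ => (hev i).sub (integrable_const _)).norm
  have hsq : ∀ z, (S z * S z).IsSymm := fun z => by
    rw [Matrix.IsSymm, Matrix.transpose_mul, (hsymm z).eq]
  -- Khintchine for the squares bounds the sign average by √(11 L ρ Y), with Y the norm of ∑ S_i².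
  -- Then 2√(11 L ρ Y) ≤ 22 L ρ + Y/2, with weights chosen so that Y gets a coefficient below 1.
  have h1 : ∀ z : ι → 𝒵, 2 * ∑ e, ‖signedSum (fun i => S (z i) * S (z i)) e‖
      ≤ N * (22 * L * ρ z + 1 / 2 * ‖∑ i, S (z i) * S (z i)‖) := by
    intro z
    set Y := ‖∑ i, S (z i) * S (z i)‖
    have hY0 : 0 ≤ Y := norm_nonneg _
    have h2 := sum_norm_signedSum_sq_le (H := fun i => S (z i) * S (z i))
      (fun i => hsq (z i)) hd
    have h3 := norm_sum_pow_four_le (H := fun i => S (z i)) (fun i => hsymm (z i)) (hSρ z) (hρ0 z)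
    have h4 : (∑ e, ‖signedSum (fun i => S (z i) * S (z i)) e‖) ^ 2
        ≤ N * ∑ e, ‖signedSum (fun i => S (z i) * S (z i)) e‖ ^ 2 := sq_sum_le_card_mul_sum_sq
    have h5 : N * ∑ e, ‖signedSum (fun i => S (z i) * S (z i)) e‖ ^ 2
        ≤ N * (N * (11 * L * (ρ z * Y))) := by
      refine mul_le_mul_of_nonneg_left (h2.trans ?_) hN.le
      gcongr
    have h6 := hρ0 z
    refine le_of_sq_le_sq ?_ (by positivity)
    have h7 := sq_nonneg (N * (22 * L * ρ z - 1 / 2 * Y))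
    nlinarith
  have h2 : ∀ e : ι → ℤˣ, ∫ z : ι → 𝒵, ‖∑ i, (S (z i) * S (z i) - A)‖ ∂π
      ≤ 2 * ∫ z : ι → 𝒵, ‖signedSum (fun i => S (z i) * S (z i)) e‖ ∂π := fun e => by
    simpa using integral_norm_centered_sum_pow_le le_rfl hS2 e
  have hsi : ∀ e : ι → ℤˣ, Integrable
      (fun z : ι → 𝒵 => ‖signedSum (fun i => S (z i) * S (z i)) e‖) π := fun e => by
    simpa using (memLp_signedSum hS2 e).integrable_norm_pow one_ne_zero
  have h3 : ∫ z : ι → 𝒵, ‖∑ i, (S (z i) * S (z i) - A)‖ ∂π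
      ≤ 22 * L * (∫ z, ρ z ∂π) + 1 / 2 * ∫ z : ι → 𝒵, ‖∑ i, S (z i) * S (z i)‖ ∂π := by
    have h4 := Finset.sum_le_sum fun e (_ : e ∈ Finset.univ) => h2 e
    rw [Finset.sum_const, nsmul_eq_mul, Finset.card_univ, ← Finset.mul_sum,
      ← integral_finsetSum _ fun e _ => hsi e] at h4
    have h5 := integral_mono ((integrable_finsetSum Finset.univ fun e _ => hsi e).const_mul 2)
      (((hρ.const_mul (22 * L)).add (hY.const_mul (1 / 2))).const_mul N) h1
    rw [integral_const_mul] at h5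
    have h6 := h4.trans h5
    simp only [Pi.add_apply] at h6
    rw [integral_const_mul, integral_add (hρ.const_mul _) (hY.const_mul _), integral_const_mul,
      integral_const_mul] at h6
    exact le_of_mul_le_mul_left h6 hN
  have h4 : ∫ z : ι → 𝒵, ‖∑ i, S (z i) * S (z i)‖ ∂π
      ≤ ∫ z : ι → 𝒵, (‖∑ i, (S (z i) * S (z i) - A)‖ + Fintype.card ι * ‖A‖) ∂π := by
    refine integral_mono hY (hJ.add (integrable_const _)) fun z => ?_
    have h5 : ∑ i, S (z i) * S (z i)
        = ∑ i, (S (z i) * S (z i) - A) + (Fintype.card ι : ℝ) • A := by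
      rw [Finset.sum_sub_distrib, Finset.sum_const, Finset.card_univ, Nat.cast_smul_eq_nsmul,
        sub_add_cancel]
    simp only
    conv_lhs => rw [h5]
    refine (norm_add_le _ _).trans_eq ?_
    rw [norm_smul, Real.norm_natCast]
  rw [integral_add hJ (integrable_const _), integral_const, probReal_univ, one_smul] at h4
  -- Half of the finite quantity E‖∑ S_i²‖ is absorbed into the left side, which doubles the other
  -- terms.
  linarith

/-- A Rosenthal-type inequality for the spectral norm of a centred sum of independent,
identically distributed random symmetric matrices. -/
theorem integral_norm_centered_sum_sq_le {S : 𝒵 → Matrix d d ℝ} (hsymm : ∀ z, (S z).IsSymm)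
    (hS : MemLp S 2 μ) (hd : 3 ≤ Fintype.card d) {ρ : (ι → 𝒵) → ℝ}
    (hρ : Integrable ρ (Measure.pi fun _ => μ)) (hSρ : ∀ z i, ‖S (z i)‖ ^ 2 ≤ ρ z)
    (hρ0 : ∀ z, 0 ≤ ρ z) :
    ∫ z : ι → 𝒵, ‖∑ i, (S (z i) - ∫ y, S y ∂μ)‖ ^ 2 ∂(Measure.pi fun _ => μ)
      ≤ 88 * Real.log (Fintype.card d) * (Fintype.card ι * ‖∫ y, S y * S y ∂μ‖)
        + 1936 * Real.log (Fintype.card d) ^ 2 * ∫ z, ρ z ∂(Measure.pi fun _ => μ) := by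
  classical
  have hQ := integral_norm_sum_mul_self_le hsymm hS hd hρ hSρ hρ0
  set π : Measure (ι → 𝒵) := Measure.pi fun _ => μ
  set L := Real.log (Fintype.card d)
  set N : ℝ := (Fintype.card (ι → ℤˣ) : ℝ)
  have hL : 0 ≤ L := Real.log_natCast_nonneg _
  have hN : 0 < N := by simp only [N]; exact_mod_cast Fintype.card_pos
  have hS' : MemLp S (2 : ℕ) μ := by simpa using hS
  have hsi : ∀ e : ι → ℤˣ, Integrable
      (fun z : ι → 𝒵 => ‖signedSum (fun i => S (z i)) e‖ ^ 2) π := fun e =>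
    (memLp_signedSum hS' e).integrable_norm_pow two_ne_zero
  have hY : Integrable (fun z : ι → 𝒵 => ‖∑ i, S (z i) * S (z i)‖) π :=
    (integrable_finsetSum _ fun i _ => integrable_comp_eval (μ := fun _ : ι => μ)
      (i := i) (f := fun z => S z * S z) (memLp_one_iff_integrable.1 (memLp_one_mul_self hS))).norm
  have h4 := Finset.sum_le_sum fun (e : ι → ℤˣ) (_ : e ∈ Finset.univ) =>
    integral_norm_centered_sum_pow_le one_le_two hS' e
  rw [Finset.sum_const, nsmul_eq_mul, Finset.card_univ, ← Finset.mul_sum,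
    ← integral_finsetSum _ fun e _ => hsi e] at h4
  have h5 := integral_mono (integrable_finsetSum Finset.univ fun e _ => hsi e)
    ((hY.const_mul (11 * L)).const_mul N) fun z =>
      sum_norm_signedSum_sq_le (H := fun i => S (z i)) (fun i => hsymm (z i)) hd
  rw [integral_const_mul, integral_const_mul] at h5
  -- Here 44 = 4 · 11: symmetrization of squares costs 4 and Khintchine costs 11.
  have h6 : N * ∫ z : ι → 𝒵, ‖∑ i, (S (z i) - ∫ y, S y ∂μ)‖ ^ 2 ∂π
      ≤ N * (44 * L * ∫ z : ι → 𝒵, ‖∑ i, S (z i) * S (z i)‖ ∂π) := by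
    refine h4.trans ((mul_le_mul_of_nonneg_left h5 (by positivity)).trans_eq ?_)
    ring
  refine (le_of_mul_le_mul_left h6 hN).trans
    ((mul_le_mul_of_nonneg_left hQ (by positivity)).trans_eq ?_)
  ring

end MatrixMoment

/-! ### Exponential and fourth moments of Gaussian variables -/

section Gaussian

theorem gaussianPDFReal_mul_exp_sq (v : NNReal) (c : ℝ) (x : ℝ) :
    gaussianPDFReal 0 v x * Real.exp (x ^ 2 / (4 * c))
      = (√(2 * Real.pi * v))⁻¹ * Real.exp (-(1 / (2 * v) - 1 / (4 * c)) * x ^ 2) := by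
  rw [gaussianPDFReal, mul_assoc, ← Real.exp_add]
  congr 2
  ring

theorem integrable_exp_sq_gaussianReal {v : NNReal} {c : ℝ} (hvc : v ≤ c) :
    Integrable (fun x => Real.exp (x ^ 2 / (4 * c))) (gaussianReal 0 v) ∧
      ∫ x, Real.exp (x ^ 2 / (4 * c)) ∂gaussianReal 0 v ≤ 2 := by
  rcases eq_or_ne v 0 with rfl | hv
  · rw [gaussianReal_zero_var]
    refine ⟨integrable_dirac (by simp), ?_⟩
    rw [integral_dirac]
    simp
  · have hv0 : (0 : ℝ) < v := by exact_mod_cast pos_iff_ne_zero.2 hv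
    -- At least half of the Gaussian exponent 1/(2v) survives the factor exp(x²/(4c)), so the
    -- integral grows by at most √2.
    have hb : 1 / (4 * (v : ℝ)) ≤ 1 / (2 * v) - 1 / (4 * c) := by
      have h1 : 1 / (4 * c) ≤ 1 / (4 * (v : ℝ)) := by gcongr
      have h2 : 1 / (2 * (v : ℝ)) = 2 * (1 / (4 * v)) := by field_simp; norm_num
      linarith
    have hb0 : 0 < 1 / (2 * (v : ℝ)) - 1 / (4 * c) := lt_of_lt_of_le (by positivity) hb
    constructor
    · rw [gaussianReal_of_var_ne_zero _ hv, integrable_withDensity_iff_integrable_smul'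
        (measurable_gaussianPDF _ _) (.of_forall fun _ => gaussianPDF_lt_top)]
      simp only [toReal_gaussianPDF, smul_eq_mul, gaussianPDFReal_mul_exp_sq]
      exact (integrable_exp_neg_mul_sq hb0).const_mul _
    · rw [integral_gaussianReal_eq_integral_smul hv]
      simp only [smul_eq_mul, gaussianPDFReal_mul_exp_sq]
      rw [integral_const_mul, integral_gaussian, inv_mul_le_iff₀ (by positivity),
        show √(2 * Real.pi * v) * 2 = √(2 * Real.pi * v * 2 ^ 2) by
          rw [Real.sqrt_mul' _ (sq_nonneg (2 : ℝ)), Real.sqrt_sq (by norm_num)]]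
      refine Real.sqrt_le_sqrt ?_
      rw [div_le_iff₀ hb0]
      calc Real.pi ≤ 2 * Real.pi * v * 2 ^ 2 * (1 / (4 * v)) := by
            field_simp
            norm_num
        _ ≤ _ := by gcongr

variable {Ω : Type*} [MeasurableSpace Ω] {P : Measure Ω}

theorem _root_.ProbabilityTheory.HasGaussianLaw.integrable_exp_sq {Y : Ω → ℝ}
    (hY : HasGaussianLaw Y P) (h0 : ∫ ω, Y ω ∂P = 0) {c : ℝ}
    (hvar : ∫ ω, Y ω ^ 2 ∂P ≤ c) :
    Integrable (fun ω => Real.exp (Y ω ^ 2 / (4 * c))) P ∧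
      ∫ ω, Real.exp (Y ω ^ 2 / (4 * c)) ∂P ≤ 2 := by
  have hv : ((Var[Y; P].toNNReal : NNReal) : ℝ) ≤ c := by
    rw [Real.coe_toNNReal _ (variance_nonneg _ _), variance_of_integral_eq_zero hY.aemeasurable h0]
    exact hvar
  have hlaw : P.map Y = gaussianReal 0 Var[Y; P].toNNReal := by rw [hY.map_eq_gaussianReal, h0]
  obtain ⟨h1, h2⟩ := integrable_exp_sq_gaussianReal hv
  rw [← hlaw] at h1 h2
  have hm : AEStronglyMeasurable (fun x : ℝ => Real.exp (x ^ 2 / (4 * c))) (P.map Y) := h1.1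
  exact ⟨h1.comp_aemeasurable hY.aemeasurable, by rwa [integral_map hY.aemeasurable hm] at h2⟩

theorem mul_le_exp_add_exp {s t : ℝ} (hs : 0 ≤ s) (ht : 0 ≤ t) :
    s * t ≤ Real.exp s + Real.exp t := by
  have h1 := Real.quadratic_le_exp_of_nonneg hs
  have h2 := Real.quadratic_le_exp_of_nonneg ht
  nlinarith [sq_nonneg (s - t)]

theorem integrable_sq_mul_sq {Y Z : Ω → ℝ} (hY : HasGaussianLaw Y P) (hZ : HasGaussianLaw Z P) :
    Integrable (fun ω => Y ω ^ 2 * Z ω ^ 2) P := by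
  have h1 := (hY.memLp (p := 4) (by simp)).integrable_norm_pow (p := 4) (by simp)
  have h2 := (hZ.memLp (p := 4) (by simp)).integrable_norm_pow (p := 4) (by simp)
  refine (h1.add h2).mono' ?_ (.of_forall fun ω => ?_)
  · exact (hY.aemeasurable.aestronglyMeasurable.pow 2).mul
      (hZ.aemeasurable.aestronglyMeasurable.pow 2)
  · have h3 : ∀ a : ℝ, ‖a‖ ^ 4 = (a ^ 2) ^ 2 := fun a => by
      rw [← sq_abs a, ← pow_mul, Real.norm_eq_abs]
    rw [Real.norm_of_nonneg (by positivity), Pi.add_apply, h3, h3]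
    nlinarith [sq_nonneg (Y ω ^ 2 - Z ω ^ 2)]

/-- Apply st ≤ e^s + e^t to s = Y²/(4a) and t = Z²/(4b), whose exponentials have mean at most 2;
hence 64 = 16 · (2 + 2). Neither independence nor joint Gaussianity is involved. A zero bound forces
its variable to vanish almost surely. -/
theorem integral_sq_mul_sq_le {Y Z : Ω → ℝ} (hY : HasGaussianLaw Y P) (hZ : HasGaussianLaw Z P)
    (hY0 : ∫ ω, Y ω ∂P = 0) (hZ0 : ∫ ω, Z ω ∂P = 0) {a b : ℝ}
    (ha : ∫ ω, Y ω ^ 2 ∂P ≤ a) (hb : ∫ ω, Z ω ^ 2 ∂P ≤ b) :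
    ∫ ω, Y ω ^ 2 * Z ω ^ 2 ∂P ≤ 64 * (a * b) := by
  have key : ∀ {Y : Ω → ℝ}, HasGaussianLaw Y P → ∀ {a : ℝ}, ∫ ω, Y ω ^ 2 ∂P ≤ a →
      0 < a ∨ a = 0 ∧ Y =ᵐ[P] 0 := by
    intro Y hY a ha
    have h0 : 0 ≤ ∫ ω, Y ω ^ 2 ∂P := integral_nonneg fun ω => sq_nonneg _
    rcases (h0.trans ha).lt_or_eq with h | rfl
    · exact Or.inl h
    · refine Or.inr ⟨rfl, ?_⟩
      have h1 := (integral_eq_zero_iff_of_nonneg (fun ω => sq_nonneg (Y ω))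
        hY.memLp_two.integrable_sq).1 (le_antisymm ha h0)
      filter_upwards [h1] with ω hω
      simpa using hω
  rcases key hY ha with ha0 | ⟨rfl, h⟩
  · rcases key hZ hb with hb0 | ⟨rfl, h⟩
    · obtain ⟨i1, h1⟩ := hY.integrable_exp_sq hY0 ha
      obtain ⟨i2, h2⟩ := hZ.integrable_exp_sq hZ0 hb
      calc ∫ ω, Y ω ^ 2 * Z ω ^ 2 ∂P
          ≤ ∫ ω, 16 * (a * b) * (Real.exp (Y ω ^ 2 / (4 * a)) + Real.exp (Z ω ^ 2 / (4 * b)))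
            ∂P := by
            refine integral_mono (integrable_sq_mul_sq hY hZ) ((i1.add i2).const_mul _) fun ω => ?_
            have h3 := mul_le_exp_add_exp (s := Y ω ^ 2 / (4 * a)) (t := Z ω ^ 2 / (4 * b))
              (by positivity) (by positivity)
            calc Y ω ^ 2 * Z ω ^ 2
                = 16 * (a * b) * (Y ω ^ 2 / (4 * a) * (Z ω ^ 2 / (4 * b))) := by
                  field_simp; norm_num
              _ ≤ _ := by gcongr
        _ ≤ 16 * (a * b) * (2 + 2) := by
            rw [integral_const_mul, integral_add i1 i2]
            gcongr
        _ = _ := by ring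
    · refine le_of_eq ?_
      rw [mul_zero, mul_zero]
      refine integral_eq_zero_of_ae ?_
      filter_upwards [h] with ω hω
      simp [hω]
  · refine le_of_eq ?_
    rw [zero_mul, mul_zero]
    refine integral_eq_zero_of_ae ?_
    filter_upwards [h] with ω hω
    simp [hω]

/-- Beyond the level a, y/a ≤ exp(y/a - 1); squaring gives exp(2(y - a)/a), and a ≥ 2 makes this at
most exp(y - a). This truncates at a with an exponentially small correction. -/
theorem sq_le_mul_one_add_exp {a y : ℝ} (ha : 2 ≤ a) (hy : 0 ≤ y) :
    y ^ 2 ≤ a ^ 2 * (1 + Real.exp (y - a)) := by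
  have ha0 : 0 < a := by linarith
  rcases le_total y a with h | h
  · have : y ^ 2 ≤ a ^ 2 := by gcongr
    nlinarith [Real.exp_pos (y - a), sq_nonneg a]
  · have h1 : y / a ≤ Real.exp (y / a - 1) := by linarith [Real.add_one_le_exp (y / a - 1)]
    have h2 : y / a - 1 = (y - a) / a := by field_simp
    have h3 : (y / a) ^ 2 ≤ Real.exp (y - a) := by
      calc (y / a) ^ 2 ≤ Real.exp (y / a - 1) ^ 2 := by gcongr
        _ = Real.exp (2 * ((y - a) / a)) := by rw [← Real.exp_nat_mul, h2]; norm_num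
        _ ≤ _ := by
          refine Real.exp_le_exp.2 ?_
          rw [← mul_div_assoc, div_le_iff₀ ha0]
          nlinarith
    rw [div_pow, div_le_iff₀ (by positivity)] at h3
    nlinarith [sq_nonneg a]

variable {p : ℕ} {x : Ω → EuclideanSpace ℝ (Fin p)}

theorem _root_.ProbabilityTheory.HasGaussianLaw.dotProduct (hx : HasGaussianLaw x P)
    (w : Fin p → ℝ) : HasGaussianLaw (fun ω => w ⬝ᵥ (x ω).ofLp) P := by
  have h : (fun ω => w ⬝ᵥ (x ω).ofLp) = fun ω => innerSL ℝ (WithLp.toLp 2 w) (x ω) := by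
    funext ω
    simp [PiLp.inner_apply, _root_.dotProduct, mul_comm]
  rw [h]
  exact hx.map_fun _

theorem integral_dotProduct_eq_zero (hx : HasGaussianLaw x P) (h0 : ∫ ω, x ω ∂P = 0)
    (w : Fin p → ℝ) : ∫ ω, w ⬝ᵥ (x ω).ofLp ∂P = 0 := by
  have := (innerSL ℝ (WithLp.toLp 2 w)).integral_comp_comm hx.integrable
  rw [h0, map_zero] at this
  rw [← this]
  refine integral_congr_ae (.of_forall fun ω => ?_)
  simp [PiLp.inner_apply, dotProduct, mul_comm]

theorem _root_.ProbabilityTheory.HasGaussianLaw.coord (hx : HasGaussianLaw x P) (i : Fin p) :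
    HasGaussianLaw (fun ω => x ω i) P := by
  simpa using hx.dotProduct (Pi.single i 1)

theorem integral_coord_eq_zero (hx : HasGaussianLaw x P) (h0 : ∫ ω, x ω ∂P = 0) (i : Fin p) :
    ∫ ω, x ω i ∂P = 0 := by
  simpa using integral_dotProduct_eq_zero hx h0 (Pi.single i 1)

theorem integrable_coord_mul_coord (hx : HasGaussianLaw x P) (i j : Fin p) :
    Integrable (fun ω => x ω i * x ω j) P :=
  (hx.coord i).memLp_two.integrable_mul (hx.coord j).memLp_two

theorem integral_dotProduct_sq (hx : HasGaussianLaw x P) (w : Fin p → ℝ) :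
    ∫ ω, (w ⬝ᵥ (x ω).ofLp) ^ 2 ∂P = w ⬝ᵥ covMatrix P x *ᵥ w := by
  have h1 : ∀ ω, (w ⬝ᵥ (x ω).ofLp) ^ 2 = ∑ i, ∑ j, w i * w j * (x ω i * x ω j) := fun ω => by
    rw [sq, dotProduct, Finset.sum_mul_sum]
    exact Finset.sum_congr rfl fun i _ => Finset.sum_congr rfl fun j _ => by ring
  simp only [h1]
  rw [integral_finsetSum _ fun i _ => integrable_finsetSum _ fun j _ =>
    (integrable_coord_mul_coord hx i j).const_mul _]
  simp only [dotProduct, Matrix.mulVec, covMatrix, Matrix.of_apply, Finset.mul_sum]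
  refine Finset.sum_congr rfl fun i _ => ?_
  rw [integral_finsetSum _ fun j _ => (integrable_coord_mul_coord hx i j).const_mul _]
  refine Finset.sum_congr rfl fun j _ => ?_
  rw [integral_const_mul]
  ring

theorem abs_le_maxNorm (A : Matrix (Fin p) (Fin p) ℝ) (i j : Fin p) : |A i j| ≤ maxNorm A :=
  le_ciSup (f := fun ij : Fin p × Fin p => |A ij.1 ij.2|) (Set.finite_range _).bddAbove (i, j)

theorem maxNorm_nonneg (A : Matrix (Fin p) (Fin p) ℝ) : 0 ≤ maxNorm A :=
  Real.iSup_nonneg fun _ => abs_nonneg _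

theorem colNorm_nonneg (A : Matrix (Fin p) (Fin p) ℝ) : 0 ≤ colNorm A :=
  Real.iSup_nonneg fun _ => Real.sqrt_nonneg _

theorem sum_sq_le_colNorm_sq (A : Matrix (Fin p) (Fin p) ℝ) (j : Fin p) :
    ∑ i, A i j ^ 2 ≤ colNorm A ^ 2 := by
  rw [← Real.sq_sqrt (Finset.sum_nonneg fun i _ => sq_nonneg (A i j))]
  gcongr
  exact le_ciSup (f := fun j : Fin p => √(∑ i, A i j ^ 2)) (Set.finite_range _).bddAbove j

theorem integral_coord_sq_le (i : Fin p) :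
    ∫ ω, x ω i ^ 2 ∂P ≤ maxNorm (covMatrix P x) := by
  refine le_trans (le_of_eq ?_) ((le_abs_self _).trans (abs_le_maxNorm (covMatrix P x) i i))
  simp [covMatrix, sq]

end Gaussian

/-! ### The masked rank-one matrix: norm and second moment -/

section Masked

variable {p : ℕ} (M : Matrix (Fin p) (Fin p) ℝ)

/-- The masked rank-one matrix `M ⊙ z z*`. -/
def maskedOuter (z : EuclideanSpace ℝ (Fin p)) : Matrix (Fin p) (Fin p) ℝ :=
  M ⊙ Matrix.vecMulVec z.ofLp z.ofLp

theorem maskedOuter_apply (z : EuclideanSpace ℝ (Fin p)) (i j : Fin p) :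
    maskedOuter M z i j = M i j * (z i * z j) := rfl

theorem maskedOuter_eq (z : EuclideanSpace ℝ (Fin p)) :
    maskedOuter M z = Matrix.diagonal z.ofLp * M * Matrix.diagonal z.ofLp := by
  ext i j
  rw [Matrix.mul_diagonal, Matrix.diagonal_mul, maskedOuter_apply]
  ring

theorem continuous_maskedOuter : Continuous (maskedOuter M) := by
  refine continuous_matrix fun i j => ?_
  simp only [maskedOuter_apply]
  fun_prop

/-- The norm of `z.ofLp` is the sup norm, which is the spectral norm of the diagonal matrix in the
factorization D M D. -/
theorem norm_maskedOuter_le (z : EuclideanSpace ℝ (Fin p)) :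
    ‖maskedOuter M z‖ ≤ ‖M‖ * ‖z.ofLp‖ ^ 2 := by
  rw [maskedOuter_eq]
  calc _ ≤ ‖Matrix.diagonal z.ofLp‖ * ‖M‖ * ‖Matrix.diagonal z.ofLp‖ :=
        (norm_mul_le _ _).trans (by gcongr; exact norm_mul_le _ _)
    _ = _ := by rw [Matrix.l2_opNorm_diagonal]; ring

theorem norm_maskedOuter_sq_le {c a : ℝ} (hc : 0 < c) (ha : 2 ≤ a)
    (z : EuclideanSpace ℝ (Fin p)) :
    ‖maskedOuter M z‖ ^ 2
      ≤ 16 * ‖M‖ ^ 2 * c ^ 2 * a ^ 2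
        * (1 + Real.exp (-a) * ∑ i, Real.exp (z i ^ 2 / (4 * c))) := by
  have h1 : ‖maskedOuter M z‖ ^ 2 ≤ ‖M‖ ^ 2 * (‖z.ofLp‖ ^ 2) ^ 2 := by
    rw [← mul_pow]
    gcongr
    exact norm_maskedOuter_le M z
  refine h1.trans ?_
  rcases isEmpty_or_nonempty (Fin p) with hp | hp
  · have h2 : ‖z.ofLp‖ = 0 := by rw [Subsingleton.elim z.ofLp 0, norm_zero]
    rw [h2]
    simp only [ne_eq, OfNat.ofNat_ne_zero, not_false_eq_true, zero_pow, mul_zero]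
    positivity
  · obtain ⟨i, hi⟩ := Finite.exists_max fun i => ‖z i‖
    have h2 : ‖z.ofLp‖ ≤ ‖z i‖ := (pi_norm_le_iff_of_nonempty _).2 hi
    have h3 : ‖z.ofLp‖ ^ 2 ≤ z i ^ 2 := by rw [← sq_abs (z i), ← Real.norm_eq_abs]; gcongr
    have h4 : Real.exp (‖z.ofLp‖ ^ 2 / (4 * c) - a)
        ≤ Real.exp (-a) * ∑ i, Real.exp (z i ^ 2 / (4 * c)) := by
      rw [sub_eq_add_neg, Real.exp_add, mul_comm]
      gcongr
      refine le_trans ?_ (Finset.single_le_sum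
        (f := fun i => Real.exp (z i ^ 2 / (4 * c))) (fun j _ => (Real.exp_pos _).le)
        (Finset.mem_univ i))
      gcongr
    calc ‖M‖ ^ 2 * (‖z.ofLp‖ ^ 2) ^ 2
        = 16 * ‖M‖ ^ 2 * c ^ 2 * (‖z.ofLp‖ ^ 2 / (4 * c)) ^ 2 := by field_simp; norm_num
      _ ≤ 16 * ‖M‖ ^ 2 * c ^ 2 * (a ^ 2 * (1 + Real.exp (‖z.ofLp‖ ^ 2 / (4 * c) - a))) := by
        gcongr
        exact sq_le_mul_one_add_exp ha (by positivity)
      _ ≤ 16 * ‖M‖ ^ 2 * c ^ 2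
          * (a ^ 2 * (1 + Real.exp (-a) * ∑ i, Real.exp (z i ^ 2 / (4 * c)))) := by gcongr
      _ = _ := by ring

variable {M}

theorem isSymm_maskedOuter (hM : M.IsSymm) (z : EuclideanSpace ℝ (Fin p)) :
    (maskedOuter M z).IsSymm := by
  ext i j
  rw [Matrix.transpose_apply, maskedOuter_apply, maskedOuter_apply, hM.apply, mul_comm (z j)]

theorem maskedOuter_mulVec_dotProduct_self (z : EuclideanSpace ℝ (Fin p)) (u : Fin p → ℝ) :
    (maskedOuter M z *ᵥ u) ⬝ᵥ (maskedOuter M z *ᵥ u)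
      = ∑ k, z k ^ 2 * ((fun j => M k j * u j) ⬝ᵥ z.ofLp) ^ 2 := by
  refine Finset.sum_congr rfl fun k _ => ?_
  have : (maskedOuter M z *ᵥ u) k = z k * ((fun j => M k j * u j) ⬝ᵥ z.ofLp) := by
    simp only [Matrix.mulVec, dotProduct, Finset.mul_sum, maskedOuter_apply]
    exact Finset.sum_congr rfl fun j _ => by ring
  rw [this]
  ring

theorem map_integral_matrix {Ω d : Type*} [Fintype d] [DecidableEq d] [MeasurableSpace Ω]
    {P : Measure Ω} {f : Ω → Matrix d d ℝ} (hf : Integrable f P) (l : Matrix d d ℝ →ₗ[ℝ] ℝ) :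
    l (∫ ω, f ω ∂P) = ∫ ω, l (f ω) ∂P :=
  ((LinearMap.toContinuousLinearMap l).integral_comp_comm hf).symm

theorem norm_integral_mul_self_le {Ω d : Type*} [Fintype d] [DecidableEq d] [MeasurableSpace Ω]
    {P : Measure Ω} {S : Ω → Matrix d d ℝ} (hsymm : ∀ ω, (S ω).IsSymm)
    (hS : Integrable (fun ω => S ω * S ω) P) {c : ℝ} (hc : 0 ≤ c)
    (h : ∀ u, ∫ ω, (S ω *ᵥ u) ⬝ᵥ (S ω *ᵥ u) ∂P ≤ c * (u ⬝ᵥ u)) :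
    ‖∫ ω, S ω * S ω ∂P‖ ≤ c := by
  have hq : ∀ u : d → ℝ, u ⬝ᵥ (∫ ω, S ω * S ω ∂P) *ᵥ u
      = ∫ ω, (S ω *ᵥ u) ⬝ᵥ (S ω *ᵥ u) ∂P := by
    intro u
    let l : Matrix d d ℝ →ₗ[ℝ] ℝ :=
      { toFun := fun A => u ⬝ᵥ A *ᵥ u
        map_add' := fun A B => by rw [Matrix.add_mulVec, dotProduct_add]
        map_smul' := fun r A => by
          rw [Matrix.smul_mulVec, dotProduct_smul, RingHom.id_apply] }
    refine (map_integral_matrix hS l).trans ?_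
    exact integral_congr_ae (.of_forall fun ω => dotProduct_mul_self_mulVec (hsymm ω) u)
  refine norm_le_of_posSemidef (.of_dotProduct_mulVec_nonneg ?_ fun u => ?_) hc
    fun u => (hq u).trans_le (h u)
  · ext i j
    rw [Matrix.conjTranspose_apply, star_trivial]
    have e : ∀ i j, (∫ ω, S ω * S ω ∂P) i j = ∫ ω, (S ω * S ω) i j ∂P := fun i j =>
      map_integral_matrix hS (Matrix.entryLinearMap ℝ ℝ i j)
    rw [e, e]
    congr 1
    funext ω
    have : (S ω * S ω).IsSymm := by rw [Matrix.IsSymm, Matrix.transpose_mul, (hsymm ω).eq]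
    exact this.apply i j
  · rw [star_trivial, hq u]
    exact integral_nonneg fun ω => by
      change 0 ≤ _
      rw [← norm_toLp_sq]; positivity

variable {Ω : Type*} [MeasurableSpace Ω] {P : Measure Ω} {x : Ω → EuclideanSpace ℝ (Fin p)}

theorem memLp_maskedOuter (hx : HasGaussianLaw x P) (M : Matrix (Fin p) (Fin p) ℝ) :
    MemLp (fun ω => maskedOuter M (x ω)) 2 P := by
  have hm : AEStronglyMeasurable (fun ω => maskedOuter M (x ω)) P :=
    (continuous_maskedOuter M).comp_aestronglyMeasurable hx.aemeasurable.aestronglyMeasurable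
  rw [memLp_two_iff_integrable_sq_norm hm]
  refine Integrable.mono' (((hx.memLp (p := 4) (by simp)).integrable_norm_pow
    (p := 4) (by simp)).const_mul (‖M‖ ^ 2)) (hm.norm.pow 2) (.of_forall fun ω => ?_)
  rw [Real.norm_of_nonneg (sq_nonneg _)]
  have h : ‖(x ω).ofLp‖ ≤ ‖x ω‖ :=
    (pi_norm_le_iff_of_nonneg (norm_nonneg _)).2 fun i => PiLp.norm_apply_le (x ω) i
  calc ‖maskedOuter M (x ω)‖ ^ 2 ≤ (‖M‖ * ‖x ω‖ ^ 2) ^ 2 := by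
        gcongr
        exact (norm_maskedOuter_le M (x ω)).trans (by gcongr)
    _ = _ := by ring

theorem integral_maskedOuter (hx : HasGaussianLaw x P) (M : Matrix (Fin p) (Fin p) ℝ) :
    ∫ ω, maskedOuter M (x ω) ∂P = M ⊙ covMatrix P x := by
  have hP := hx.isProbabilityMeasure
  have hint := (memLp_maskedOuter hx M).integrable one_le_two
  ext i j
  refine (map_integral_matrix hint (Matrix.entryLinearMap ℝ ℝ i j)).trans ?_
  simp only [Matrix.entryLinearMap_apply, maskedOuter_apply, Matrix.hadamard_apply, covMatrix,
    Matrix.of_apply]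
  exact integral_const_mul _ _

/-- Row k contributes x_k² times the square of a linear form in x with coefficients M k j * u j. The
fourth-moment bound splits its mean into ‖Σ‖_max and ‖Σ‖ ∑_j M k j ^ 2 * u j ^ 2; summing over k
leaves column norms of M. -/
theorem norm_integral_maskedOuter_sq_le (hx : HasGaussianLaw x P) (h0 : ∫ ω, x ω ∂P = 0)
    (hM : M.IsSymm) :
    ‖∫ ω, maskedOuter M (x ω) * maskedOuter M (x ω) ∂P‖
      ≤ 64 * (maxNorm (covMatrix P x) * ‖covMatrix P x‖ * colNorm M ^ 2) := by
  have hσ := maxNorm_nonneg (covMatrix P x)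
  refine norm_integral_mul_self_le (fun ω => isSymm_maskedOuter hM (x ω))
    (memLp_one_iff_integrable.1 (memLp_one_mul_self (memLp_maskedOuter hx M))) (by positivity)
    fun u => ?_
  simp only [maskedOuter_mulVec_dotProduct_self]
  rw [integral_finsetSum _ fun k _ => integrable_sq_mul_sq (hx.coord k) (hx.dotProduct _)]
  calc ∑ k, ∫ ω, x ω k ^ 2 * ((fun j => M k j * u j) ⬝ᵥ (x ω).ofLp) ^ 2 ∂P
      ≤ ∑ k, 64 * (maxNorm (covMatrix P x)
          * (‖covMatrix P x‖ * ((fun j => M k j * u j) ⬝ᵥ (fun j => M k j * u j)))) := by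
        refine Finset.sum_le_sum fun k _ => ?_
        refine integral_sq_mul_sq_le (hx.coord k) (hx.dotProduct _) (integral_coord_eq_zero hx h0 k)
          (integral_dotProduct_eq_zero hx h0 _) (integral_coord_sq_le k) ?_
        rw [integral_dotProduct_sq hx]
        exact dotProduct_mulVec_le _ _
    _ = 64 * (maxNorm (covMatrix P x) * ‖covMatrix P x‖)
          * ∑ j, (∑ k, M k j ^ 2) * (u j * u j) := by
        rw [← Finset.mul_sum, ← Finset.mul_sum, ← Finset.mul_sum]
        simp only [dotProduct, Finset.sum_mul]
        rw [Finset.sum_comm]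
        simp only [← mul_assoc]
        congr 1
        exact Finset.sum_congr rfl fun j _ => Finset.sum_congr rfl fun k _ => by ring
    _ ≤ 64 * (maxNorm (covMatrix P x) * ‖covMatrix P x‖)
          * ∑ j, colNorm M ^ 2 * (u j * u j) := by
        gcongr with j
        · exact mul_self_nonneg _
        · exact sum_sq_le_colNorm_sq M j
    _ = _ := by rw [← Finset.mul_sum, dotProduct]; ring

end Masked

/-! ### The moment bound for independent Gaussian samples -/

section Moment

variable {p n : ℕ} {μ : Measure (EuclideanSpace ℝ (Fin p))}

theorem integrable_sum_exp_sq (hμ : HasGaussianLaw id μ) (h0 : ∫ z, id z ∂μ = 0) {c : ℝ}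
    (hσ : maxNorm (covMatrix μ id) ≤ c) :
    Integrable (fun z : EuclideanSpace ℝ (Fin p) => ∑ i, Real.exp (z i ^ 2 / (4 * c))) μ ∧
      ∫ z : EuclideanSpace ℝ (Fin p), ∑ i, Real.exp (z i ^ 2 / (4 * c)) ∂μ ≤ 2 * p := by
  have h := fun i => (hμ.coord i).integrable_exp_sq (integral_coord_eq_zero hμ h0 i)
    ((integral_coord_sq_le i).trans hσ)
  simp only [id_eq] at h
  refine ⟨integrable_finsetSum _ fun i _ => (h i).1, ?_⟩
  rw [integral_finsetSum _ fun i _ => (h i).1]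
  refine (Finset.sum_le_sum fun i _ => (h i).2).trans_eq ?_
  rw [Finset.sum_const, Finset.card_univ, Fintype.card_fin, nsmul_eq_mul, mul_comm]

variable [IsProbabilityMeasure μ]

theorem integral_norm_sum_maskedOuter_sq_le (hp : 3 ≤ p) (hn : 1 ≤ n) (hμ : HasGaussianLaw id μ)
    (h0 : ∫ z, id z ∂μ = 0) {M : Matrix (Fin p) (Fin p) ℝ} (hM : M.IsSymm) {c : ℝ} (hc : 0 < c)
    (hσ : maxNorm (covMatrix μ id) ≤ c) :
    ∫ z : Fin n → EuclideanSpace ℝ (Fin p),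
        ‖∑ i, (maskedOuter M (z i) - M ⊙ covMatrix μ id)‖ ^ 2 ∂(Measure.pi fun _ => μ)
      ≤ 5632 * Real.log p * n * (maxNorm (covMatrix μ id) * ‖covMatrix μ id‖ * colNorm M ^ 2)
        + 247808 * (Real.log p * ‖M‖ * c * Real.log (n * p)) ^ 2 := by
  set π : Measure (Fin n → EuclideanSpace ℝ (Fin p)) := Measure.pi fun _ => μ
  have hp' : (3 : ℝ) ≤ p := by exact_mod_cast hp
  have hn' : (1 : ℝ) ≤ n := by exact_mod_cast hn
  have hnp : (3 : ℝ) ≤ n * p := by nlinarith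
  have hlog : 1 ≤ Real.log (n * p) := by
    rw [Real.le_log_iff_exp_le (by linarith)]
    linarith [Real.exp_one_lt_d9]
  -- This level gives exp(-a) = (np)⁻², while the np exponential moments sum to at most 2np. The
  -- correction to the truncation thus has mean at most 2/(np) ≤ 1.
  set a := 2 * Real.log (n * p) with ha_def
  have ha : 2 ≤ a := by linarith
  have hexp : Real.exp (-a) = ((n * p : ℝ) ^ 2)⁻¹ := by
    rw [Real.exp_neg, ha_def, show (2 : ℝ) = ((2 : ℕ) : ℝ) by norm_num, Real.exp_nat_mul,
      Real.exp_log (by linarith)]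
  obtain ⟨hi, hle⟩ := integrable_sum_exp_sq hμ h0 hσ
  set K := 16 * ‖M‖ ^ 2 * c ^ 2 * a ^ 2 with hK
  have hK0 : 0 ≤ K := by positivity
  set g : EuclideanSpace ℝ (Fin p) → ℝ := fun z => ∑ i, Real.exp (z i ^ 2 / (4 * c))
  have hg0 : ∀ z, 0 ≤ g z := fun z => Finset.sum_nonneg fun i _ => (Real.exp_pos _).le
  have hgi : ∀ k : Fin n, Integrable (fun z : Fin n → EuclideanSpace ℝ (Fin p) => g (z k)) π :=
    fun k => integrable_comp_eval (μ := fun _ => μ) (i := k) hi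
  have hgs := integrable_finsetSum Finset.univ fun k (_ : k ∈ Finset.univ) => hgi k
  have hρ : Integrable (fun z : Fin n → EuclideanSpace ℝ (Fin p) =>
      K * (1 + Real.exp (-a) * ∑ k, g (z k))) π :=
    ((integrable_const _).add (hgs.const_mul _)).const_mul _
  have hρint : ∫ z : Fin n → EuclideanSpace ℝ (Fin p),
      K * (1 + Real.exp (-a) * ∑ k, g (z k)) ∂π ≤ 2 * K := by
    rw [integral_const_mul, integral_add (integrable_const _) (hgs.const_mul _), integral_const,
      probReal_univ, one_smul, integral_const_mul, integral_finsetSum _ fun k _ => hgi k]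
    have h1 : ∀ k : Fin n, ∫ z : Fin n → EuclideanSpace ℝ (Fin p), g (z k) ∂π ≤ 2 * p := fun k =>
      (integral_comp_eval (μ := fun _ : Fin n => μ) (i := k) hi.1).trans_le hle
    have h2 : ∑ k : Fin n, ∫ z : Fin n → EuclideanSpace ℝ (Fin p), g (z k) ∂π ≤ n * (2 * p) := by
      refine (Finset.sum_le_sum fun k _ => h1 k).trans_eq ?_
      rw [Finset.sum_const, Finset.card_univ, Fintype.card_fin, nsmul_eq_mul]
    have h3 : Real.exp (-a) * ∑ k : Fin n, ∫ z : Fin n → EuclideanSpace ℝ (Fin p), g (z k) ∂π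
        ≤ 1 := by
      rw [hexp, inv_mul_le_iff₀ (by positivity)]
      nlinarith
    nlinarith
  have hbound : ∀ (z : Fin n → EuclideanSpace ℝ (Fin p)) (k : Fin n),
      ‖maskedOuter M (z k)‖ ^ 2 ≤ K * (1 + Real.exp (-a) * ∑ k, g (z k)) := by
    intro z k
    refine (norm_maskedOuter_sq_le M hc ha (z k)).trans ?_
    have := Finset.single_le_sum (f := fun k => g (z k)) (fun k _ => hg0 (z k)) (Finset.mem_univ k)
    gcongr
  have hmain := integral_norm_centered_sum_sq_le (μ := μ) (ι := Fin n)
    (fun z => isSymm_maskedOuter hM z) (memLp_maskedOuter hμ M) (by simpa using hp) hρ hbound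
    (fun z => by have := Finset.sum_nonneg fun k (_ : k ∈ Finset.univ) => hg0 (z k); positivity)
  have hmean : ∫ y, maskedOuter M y ∂μ = M ⊙ covMatrix μ id := integral_maskedOuter hμ M
  have hv := norm_integral_maskedOuter_sq_le hμ h0 hM
  simp only [Fintype.card_fin, hmean, id_eq] at hmain hv
  refine hmain.trans ?_
  have hL : 0 ≤ Real.log p := Real.log_natCast_nonneg _
  calc _ ≤ 88 * Real.log p
          * (n * (64 * (maxNorm (covMatrix μ id) * ‖covMatrix μ id‖ * colNorm M ^ 2)))
        + 1936 * Real.log p ^ 2 * (2 * K) := by gcongr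
    _ = _ := by rw [hK, ha_def]; ring

/-- The exponential moments need a positive scale c; letting c decrease to ‖Σ‖_max covers Σ = 0 as
well. -/
theorem integral_norm_sum_maskedOuter_sq_le_maxNorm (hp : 3 ≤ p) (hn : 1 ≤ n)
    (hμ : HasGaussianLaw id μ) (h0 : ∫ z, id z ∂μ = 0) {M : Matrix (Fin p) (Fin p) ℝ}
    (hM : M.IsSymm) :
    ∫ z : Fin n → EuclideanSpace ℝ (Fin p),
        ‖∑ i, (maskedOuter M (z i) - M ⊙ covMatrix μ id)‖ ^ 2 ∂(Measure.pi fun _ => μ)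
      ≤ 5632 * Real.log p * n * (maxNorm (covMatrix μ id) * ‖covMatrix μ id‖ * colNorm M ^ 2)
        + 247808 * (Real.log p * ‖M‖ * maxNorm (covMatrix μ id) * Real.log (n * p)) ^ 2 := by
  have hcont : Continuous fun c : ℝ =>
      5632 * Real.log p * n * (maxNorm (covMatrix μ id) * ‖covMatrix μ id‖ * colNorm M ^ 2)
        + 247808 * (Real.log p * ‖M‖ * c * Real.log (n * p)) ^ 2 := by fun_prop
  refine ge_of_tendsto (hcont.continuousWithinAt (s := Set.Ioi (maxNorm (covMatrix μ id))))
    (eventually_nhdsWithin_of_forall fun c hc => ?_)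
  exact integral_norm_sum_maskedOuter_sq_le hp hn hμ h0 hM
    ((maxNorm_nonneg _).trans_lt hc) (le_of_lt hc)

theorem memLp_sum_maskedOuter (hμ : HasGaussianLaw id μ) (M : Matrix (Fin p) (Fin p) ℝ) :
    MemLp (fun z : Fin n → EuclideanSpace ℝ (Fin p) =>
      ∑ i, (maskedOuter M (z i) - M ⊙ covMatrix μ id)) 2 (Measure.pi fun _ => μ) :=
  memLp_finsetSum _ fun i _ => ((memLp_maskedOuter hμ M).comp_measurePreserving
    (measurePreserving_eval (fun _ : Fin n => μ) i)).sub (memLp_const _)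

end Moment

/-! ### Transfer to the sample covariance matrix -/

section Fluctuation

variable {p n : ℕ} {Ω : Type*} [MeasurableSpace Ω] {P : Measure Ω}
  {x : Ω → EuclideanSpace ℝ (Fin p)} {X : Fin n → Ω → EuclideanSpace ℝ (Fin p)}

theorem covMatrix_map_id {p : ℕ} {Ω : Type*} [MeasurableSpace Ω] {P : Measure Ω}
    {x : Ω → EuclideanSpace ℝ (Fin p)} (hx : AEMeasurable x P) :
    covMatrix (P.map x) id = covMatrix P x := by
  ext i j
  simp only [covMatrix, Matrix.of_apply, id_eq]
  exact integral_map hx (by fun_prop)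

theorem fluctuation_eq (hn : 1 ≤ n) (M : Matrix (Fin p) (Fin p) ℝ) (ω : Ω) :
    fluctuation P x X M ω
      = (1 / (n : ℝ)) • ∑ i, (maskedOuter M (X i ω) - M ⊙ covMatrix P x) := by
  have hn0 : (n : ℝ) ≠ 0 := by positivity
  ext i j
  simp only [fluctuation, sampleCov, Matrix.sub_apply, Matrix.hadamard_apply, Matrix.smul_apply,
    Matrix.sum_apply, Matrix.vecMulVec_apply, maskedOuter_apply, smul_eq_mul]
  simp only [Finset.sum_sub_distrib, Finset.sum_const, Finset.card_univ, Fintype.card_fin,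
    nsmul_eq_mul, ← Finset.mul_sum]
  field_simp

variable [IsProbabilityMeasure P]

theorem map_eq_pi (hX : iIndepFun X P) (hid : ∀ i, IdentDistrib (X i) x P P) :
    P.map (fun ω i => X i ω) = Measure.pi fun _ => P.map x := by
  rw [(iIndepFun_iff_map_fun_eq_pi_map fun i => (hid i).aemeasurable_fst).1 hX]
  simp only [fun i => (hid i).map_eq]

/-- The sample has the product law of copies of x, so the moment bound is pulled back along it and
scaled by 1/n². -/
theorem integral_norm_fluctuation_sq_le (hp : 3 ≤ p) (hn : 1 ≤ n) (hx : HasGaussianLaw x P)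
    (h0 : ∫ ω, x ω ∂P = 0) (hX : iIndepFun X P) (hid : ∀ i, IdentDistrib (X i) x P P)
    {M : Matrix (Fin p) (Fin p) ℝ} (hM : M.IsSymm) :
    Integrable (fun ω => ‖fluctuation P x X M ω‖ ^ 2) P ∧
      ∫ ω, ‖fluctuation P x X M ω‖ ^ 2 ∂P
        ≤ 5632 * Real.log p / n * (maxNorm (covMatrix P x) * ‖covMatrix P x‖ * colNorm M ^ 2)
          + 247808 * (Real.log p * ‖M‖ * maxNorm (covMatrix P x) * Real.log (n * p) / n) ^ 2 := by
  have hn0 : (n : ℝ) ≠ 0 := by positivity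
  have hmx := hx.aemeasurable
  have : IsProbabilityMeasure (P.map x) := Measure.isProbabilityMeasure_map hmx
  have hμ : HasGaussianLaw id (P.map x) := ⟨by rw [Measure.map_id]; exact hx.isGaussian_map⟩
  have h0' : ∫ z, id z ∂(P.map x) = 0 := by rw [integral_map hmx (by fun_prop)]; exact h0
  have hXm : AEMeasurable (fun ω i => X i ω) P := aemeasurable_pi_lambda _ fun i =>
    (hid i).aemeasurable_fst
  have hint := (memLp_sum_maskedOuter (n := n) hμ M).integrable_norm_pow two_ne_zero
  have hle := integral_norm_sum_maskedOuter_sq_le_maxNorm hp hn hμ h0' hM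
  rw [← map_eq_pi hX hid] at hint hle
  rw [integral_map hXm hint.1] at hle
  have hint' := hint.comp_aemeasurable hXm
  simp only [covMatrix_map_id hmx] at hle hint'
  have heq : ∀ ω, ‖fluctuation P x X M ω‖ ^ 2 = (1 / (n : ℝ)) ^ 2
      * ‖∑ i, (maskedOuter M (X i ω) - M ⊙ covMatrix P x)‖ ^ 2 := fun ω => by
    rw [fluctuation_eq hn, norm_smul, mul_pow, Real.norm_of_nonneg (by positivity)]
  simp only [heq]
  refine ⟨hint'.const_mul _, ?_⟩
  rw [integral_const_mul]
  refine (mul_le_mul_of_nonneg_left hle (by positivity)).trans_eq ?_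
  field_simp

theorem rmsFluctuation_le (hp : 3 ≤ p) (hn : 1 ≤ n) (hx : HasGaussianLaw x P)
    (h0 : ∫ ω, x ω ∂P = 0) (hX : iIndepFun X P) (hid : ∀ i, IdentDistrib (X i) x P P)
    {M : Matrix (Fin p) (Fin p) ℝ} (hM : M.IsSymm) :
    rmsFluctuation P x X M ≤
      500 * (√(maxNorm (covMatrix P x) / ‖covMatrix P x‖ * (colNorm M ^ 2 * Real.log p / n)) +
        maxNorm (covMatrix P x) / ‖covMatrix P x‖ * (‖M‖ * Real.log p * Real.log (n * p) / n)) *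
      ‖covMatrix P x‖ := by
  have h := (integral_norm_fluctuation_sq_le hp hn hx h0 hX hid hM).2
  have hσ0 := maxNorm_nonneg (covMatrix P x)
  have hL : 0 ≤ Real.log p := Real.log_natCast_nonneg _
  have hL2 : 0 ≤ Real.log (n * p) := by exact_mod_cast Real.log_natCast_nonneg (n * p)
  -- For Σ = 0 the quotient is 0 by the convention on division, and both sides vanish.
  have hσs : maxNorm (covMatrix P x)
      = maxNorm (covMatrix P x) / ‖covMatrix P x‖ * ‖covMatrix P x‖ := by
    rcases eq_or_ne (covMatrix P x) 0 with h | h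
    · simp [h, maxNorm]
    · rw [div_mul_cancel₀ _ (norm_ne_zero_iff.2 h)]
  rw [hσs] at h
  set s := ‖covMatrix P x‖
  have hs : 0 ≤ s := norm_nonneg _
  set r := maxNorm (covMatrix P x) / s
  have hr : 0 ≤ r := by positivity
  rw [rmsFluctuation]
  refine Real.sqrt_le_iff.2 ⟨by positivity, h.trans ?_⟩
  set y := ‖M‖ * Real.log p * Real.log (n * p) / n with hy
  have hy0 : 0 ≤ y := by positivity
  have ht : 0 ≤ r * (colNorm M ^ 2 * Real.log p / n) := by positivity
  have hsq := Real.sq_sqrt ht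
  set q := √(r * (colNorm M ^ 2 * Real.log p / n))
  have hq : 0 ≤ q := Real.sqrt_nonneg _
  calc _ = (5632 * q ^ 2 + 247808 * (r * y) ^ 2) * s ^ 2 := by rw [hsq, hy]; ring
    -- 500² = 250000 exceeds both 5632 and 247808.
    _ ≤ (500 ^ 2 * (q + r * y) ^ 2) * s ^ 2 := by
        gcongr
        nlinarith [mul_nonneg hq (mul_nonneg hr hy0), sq_nonneg q, sq_nonneg (r * y)]
    _ = _ := by ring

end Fluctuation

/-! ### Norms of banded masks -/

section Banded

variable {p b : ℕ} {M : Matrix (Fin p) (Fin p) ℝ}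

/-- The band may be wider than the matrix; the bound by p is what later permits trading powers of p
against n. -/
theorem IsBandedMask.sum_col_le (hM : IsBandedMask b M) (j : Fin p) :
    ∑ i, M i j ≤ min (2 * (b : ℝ) + 1) p := by
  have h1 : ∀ i, M i j ≤ if |(i : ℤ) - (j : ℤ)| ≤ b then 1 else 0 := by
    intro i
    split_ifs with h
    · rcases hM.zero_or_one i j with h | h <;> rw [h]
      exact zero_le_one
    · exact (hM.band i j (not_le.1 h)).le
  refine (Finset.sum_le_sum fun i _ => h1 i).trans ?_
  rw [Finset.sum_boole]
  refine le_min ?_ ?_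
  · have h2 : (Finset.univ.filter fun i : Fin p => |(i : ℤ) - (j : ℤ)| ≤ b).card
        ≤ (Finset.Icc ((j : ℤ) - b) (j + b)).card := by
      refine Finset.card_le_card_of_injOn (fun i => (i : ℤ)) (fun i hi => ?_)
        fun i _ k _ hik => Fin.ext (Nat.cast_injective (R := ℤ) hik)
      have := abs_le.1 (Finset.mem_filter.1 hi).2
      exact Finset.mem_Icc.2 ⟨by linarith, by linarith⟩
    rw [Int.card_Icc, show (j : ℤ) + b + 1 - (j - b) = ((2 * b + 1 : ℕ) : ℤ) by push_cast; ring,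
      Int.toNat_natCast] at h2
    exact_mod_cast h2
  · have := Finset.card_filter_le (Finset.univ : Finset (Fin p))
      fun i : Fin p => |(i : ℤ) - (j : ℤ)| ≤ b
    rw [Finset.card_univ, Fintype.card_fin] at this
    exact_mod_cast this

theorem IsBandedMask.sq_eq (hM : IsBandedMask b M) (i j : Fin p) : M i j ^ 2 = M i j := by
  rcases hM.zero_or_one i j with h | h <;> simp [h]

theorem IsBandedMask.nonneg (hM : IsBandedMask b M) (i j : Fin p) : 0 ≤ M i j := by
  rw [← hM.sq_eq]; positivity

theorem IsBandedMask.colNorm_sq_le (hM : IsBandedMask b M) :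
    colNorm M ^ 2 ≤ min (2 * (b : ℝ) + 1) p := by
  have h0 : (0 : ℝ) ≤ min (2 * (b : ℝ) + 1) p := by positivity
  rw [← Real.sq_sqrt h0]
  refine pow_le_pow_left₀ (colNorm_nonneg M) (Real.iSup_le (fun j => ?_) (Real.sqrt_nonneg _)) 2
  refine Real.sqrt_le_sqrt ?_
  simp only [hM.sq_eq]
  exact hM.sum_col_le j

/-- Schur's test: Cauchy–Schwarz in each row, with row and column sums at most D. -/
theorem IsBandedMask.norm_le (hM : IsBandedMask b M) : ‖M‖ ≤ min (2 * (b : ℝ) + 1) p := by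
  set D := min (2 * (b : ℝ) + 1) p
  have h0 : 0 ≤ D := by positivity
  refine norm_le_of_mulVec h0 fun u => ?_
  have hrow : ∀ i, ∑ j, M i j ≤ D := fun i => by
    simpa only [hM.symm.apply] using hM.sum_col_le i
  calc ∑ i, (M *ᵥ u) i * (M *ᵥ u) i ≤ ∑ i, D * ∑ j, M i j * (u j * u j) := by
        refine Finset.sum_le_sum fun i _ => ?_
        have h1 := Finset.sum_mul_sq_le_sq_mul_sq Finset.univ (fun j => M i j)
          (fun j => M i j * u j)
        have h2 : ∀ j, M i j * (M i j * u j) = M i j * u j := fun j => by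
          rw [← mul_assoc, ← sq, hM.sq_eq]
        simp only [h2, mul_pow, hM.sq_eq] at h1
        rw [← sq]
        refine h1.trans ?_
        simp only [← sq]
        exact mul_le_mul_of_nonneg_right (hrow i)
          (Finset.sum_nonneg fun j _ => mul_nonneg (hM.nonneg i j) (sq_nonneg _))
    _ = D * ∑ j, (∑ i, M i j) * (u j * u j) := by
        rw [← Finset.mul_sum, Finset.sum_comm]
        simp only [Finset.sum_mul]
    _ ≤ D * ∑ j, D * (u j * u j) := by
        gcongr with j
        · exact mul_self_nonneg _
        · exact hM.sum_col_le j
    _ = D ^ 2 * (u ⬝ᵥ u) := by rw [← Finset.mul_sum, dotProduct]; ring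

theorem maxNorm_le_norm (A : Matrix (Fin p) (Fin p) ℝ) : maxNorm A ≤ ‖A‖ := by
  refine Real.iSup_le (fun ij => ?_) (norm_nonneg _)
  have h := abs_dotProduct_mulVec_le A (Pi.single ij.2 1) (Pi.single ij.1 1)
  simpa using h

end Banded

/-! ### Sample complexity and the probability bound -/

section SampleSize

theorem sq_mul_log_sq_le {p n : ℝ} (hp : 1 ≤ p) (hpn : p ^ 3 ≤ n) :
    p ^ 2 * Real.log (n * p) ^ 2 ≤ 64 * n := by
  have hn : 1 ≤ n := (one_le_pow₀ hp).trans hpn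
  -- With w = n^(1/6), p ≤ w² and log(np) ≤ log(w⁸) ≤ 8w, so the product is at most 64 w⁶.
  set w := Real.exp (Real.log n / 6) with hw
  have hw0 : 0 < w := Real.exp_pos _
  have hw6 : w ^ 6 = n := by
    rw [hw, ← Real.exp_nat_mul, Nat.cast_ofNat, mul_div_cancel₀ _ (by norm_num : (6 : ℝ) ≠ 0),
      Real.exp_log (by linarith)]
  have hpw : p ≤ w ^ 2 := by
    refine le_of_pow_le_pow_left₀ three_ne_zero (by positivity) ?_
    rw [← pow_mul, hw6]
    exact hpn
  have hlog : Real.log (n * p) ≤ 8 * w := by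
    calc Real.log (n * p) ≤ Real.log (w ^ 8) := by
          refine Real.log_le_log (by positivity) ?_
          rw [← hw6]
          calc w ^ 6 * p ≤ w ^ 6 * w ^ 2 := by gcongr
            _ = w ^ 8 := by ring
      _ = 8 * Real.log w := by rw [Real.log_pow]; norm_num
      _ ≤ 8 * w := by
          have := Real.log_le_sub_one_of_pos hw0
          linarith
  have hlog0 : 0 ≤ Real.log (n * p) := Real.log_nonneg (by nlinarith)
  calc p ^ 2 * Real.log (n * p) ^ 2 ≤ (w ^ 2) ^ 2 * (8 * w) ^ 2 := by gcongr
    _ = 64 * n := by rw [← hw6]; ring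

/-- The sample size makes t = rDL/n at most 10⁻¹⁰ ε² and tL at most 10⁻¹⁰ ε. The second suffices
when log(np) ≤ 4L, that is for n ≤ p³. The target ε/10 leaves room for Markov's inequality. -/
theorem relative_error_le {p n r D B m N ε : ℝ} (hp : 3 ≤ p) (hn : 1 ≤ n) (hr : 0 ≤ r)
    (hr1 : r ≤ 1) (hm0 : 0 ≤ m) (hmD : m ≤ D) (hND : N ≤ D) (hDB : D ≤ B)
    (hDp : D ≤ p) (hε : 0 < ε)
    (h : 10 ^ 10 * (B * Real.log p / ε ^ 2 + B * Real.log p ^ 2 / ε) * r ≤ n) :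
    500 * (√(r * (m * Real.log p / n)) + r * (N * Real.log p * Real.log (n * p) / n))
      ≤ ε / 10 := by
  have hn0 : 0 < n := by linarith
  have hL0 : 0 ≤ Real.log p := Real.log_nonneg (by linarith)
  have hLp : Real.log p ≤ p := by linarith [Real.log_le_sub_one_of_pos (show 0 < p by linarith)]
  have hlog0 : 0 ≤ Real.log (n * p) := Real.log_nonneg (by nlinarith)
  have hD0 : 0 ≤ D := hm0.trans hmD
  have hB0 : 0 ≤ B := hD0.trans hDB
  set L := Real.log p
  set t := r * (D * L / n) with ht
  have ht0 : 0 ≤ t := by positivity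
  have hb1 : 10 ^ 10 * (B * L / ε ^ 2) * r ≤ n := by
    refine le_trans ?_ h
    gcongr
    have : 0 ≤ B * L ^ 2 / ε := by positivity
    linarith
  have hb2 : 10 ^ 10 * (B * L ^ 2 / ε) * r ≤ n := by
    refine le_trans ?_ h
    gcongr
    have : 0 ≤ B * L / ε ^ 2 := by positivity
    linarith
  have h1 : 10 ^ 10 * t ≤ ε ^ 2 := by
    have h2 : 10 ^ 10 * (B * L) * r ≤ n * ε ^ 2 := by
      rw [← div_le_iff₀ (by positivity)]
      refine le_trans (le_of_eq ?_) hb1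
      ring
    rw [ht, show 10 ^ 10 * (r * (D * L / n)) = 10 ^ 10 * (D * L) * r / n by ring,
      div_le_iff₀ hn0, mul_comm (ε ^ 2)]
    refine le_trans ?_ h2
    gcongr
  have h2 : 10 ^ 10 * (t * L) ≤ ε := by
    have h3 : 10 ^ 10 * (B * L ^ 2) * r ≤ n * ε := by
      rw [← div_le_iff₀ hε]
      refine le_trans (le_of_eq ?_) hb2
      ring
    rw [ht, show 10 ^ 10 * (r * (D * L / n) * L) = 10 ^ 10 * (D * L ^ 2) * r / n by ring,
      div_le_iff₀ hn0, mul_comm ε]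
    refine le_trans ?_ h3
    gcongr
  have h3 : √(r * (m * L / n)) ≤ ε / 10 ^ 5 := by
    refine Real.sqrt_le_iff.2 ⟨by positivity, ?_⟩
    calc r * (m * L / n) ≤ t := by rw [ht]; gcongr
      _ ≤ ε ^ 2 / 10 ^ 10 := by rw [le_div_iff₀ (by positivity)]; linarith
      _ = _ := by ring
  have h4 : t * Real.log (n * p) ≤ 8 * ε / 10 ^ 5 := by
    rcases le_total n (p ^ 3) with hnp | hnp
    · have h5 : Real.log (n * p) ≤ 4 * L := by
        calc Real.log (n * p) ≤ Real.log (p ^ 4) := by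
              refine Real.log_le_log (by positivity) ?_
              calc n * p ≤ p ^ 3 * p := by gcongr
                _ = p ^ 4 := by ring
          _ = 4 * L := by rw [Real.log_pow, Nat.cast_ofNat]
      calc t * Real.log (n * p) ≤ t * (4 * L) := by gcongr
        _ ≤ _ := by linarith
    · have h5 := sq_mul_log_sq_le (by linarith) hnp
      have h6 : t ≤ p ^ 2 / n := by
        rw [ht]
        calc r * (D * L / n) ≤ 1 * (p * p / n) := by gcongr
          _ = _ := by ring
      have h7 : t * Real.log (n * p) ^ 2 ≤ 64 := by
        calc t * Real.log (n * p) ^ 2 ≤ p ^ 2 / n * Real.log (n * p) ^ 2 := by gcongr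
          _ = p ^ 2 * Real.log (n * p) ^ 2 / n := by ring
          _ ≤ 64 := by rwa [div_le_iff₀ hn0]
      -- For n ≥ p³, t ≤ p²/n bounds t log(np)² by 64; multiplying by t ≤ 10⁻¹⁰ ε² bounds the square
      -- of t log(np).
      refine le_of_sq_le_sq ?_ (by positivity)
      calc (t * Real.log (n * p)) ^ 2 = t * (t * Real.log (n * p) ^ 2) := by ring
        _ ≤ (ε ^ 2 / 10 ^ 10) * 64 := by
          gcongr
          rw [le_div_iff₀ (by positivity)]; linarith
        _ = _ := by ring
  have h5 : r * (N * L * Real.log (n * p) / n) ≤ 8 * ε / 10 ^ 5 := by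
    refine le_trans ?_ h4
    rw [ht, show r * (D * L / n) * Real.log (n * p) = r * (D * L * Real.log (n * p) / n) by ring]
    gcongr
  linarith

/-- Markov for f² at level s²; the factor 1/10 becomes 1/100. When s = 0, f vanishes almost surely.
-/
theorem prob_le_of_sqrt_integral_sq_le {Ω : Type*} [MeasurableSpace Ω] {P : Measure Ω}
    [IsProbabilityMeasure P] {f : Ω → ℝ}
    (hf : Integrable (fun ω => f ω ^ 2) P) {s : ℝ} (hs : 0 ≤ s)
    (h : √(∫ ω, f ω ^ 2 ∂P) ≤ s / 10) : 99 / 100 ≤ P.real {ω | f ω ≤ s} := by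
  have hI0 : 0 ≤ ∫ ω, f ω ^ 2 ∂P := integral_nonneg fun ω => sq_nonneg _
  have h1 : ∫ ω, f ω ^ 2 ∂P ≤ s ^ 2 / 100 := by
    rw [Real.sqrt_le_left (by positivity)] at h
    linarith
  rcases hs.eq_or_lt with rfl | hs
  · have h2 := (integral_eq_zero_iff_of_nonneg (fun ω => sq_nonneg (f ω)) hf).1
      (le_antisymm (by simpa using h1) hI0)
    have h3 : P.real {ω | f ω ≤ 0} = 1 := by
      rw [← probReal_univ (μ := P)]
      refine measureReal_congr ?_
      filter_upwards [h2] with ω hω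
      exact eq_true (pow_eq_zero_iff two_ne_zero |>.1 hω).le
    rw [h3]
    norm_num
  · have h2 := mul_meas_ge_le_integral_of_nonneg (.of_forall fun ω => sq_nonneg (f ω)) hf (s ^ 2)
    have h3 : P.real {ω | s ^ 2 ≤ f ω ^ 2} ≤ 1 / 100 := by
      have := h2.trans h1
      have hs2 : 0 < s ^ 2 := by positivity
      nlinarith
    have h4 : (1 : ℝ) ≤ P.real {ω | f ω ≤ s} + P.real {ω | s ^ 2 ≤ f ω ^ 2} := by
      rw [← probReal_univ (μ := P)]
      refine le_trans (measureReal_mono fun ω _ => ?_) (measureReal_union_le _ _)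
      rcases le_total (f ω) s with h | h
      · exact Or.inl h
      · exact Or.inr (pow_le_pow_left₀ hs.le h 2)
    linarith

end SampleSize

end MaskedCov

/-! ### Assembly of the constants -/

theorem mainTheorem2 :
    ∃ C : ℝ, 0 < C ∧
      ∀ (p n : ℕ), 3 ≤ p → 1 ≤ n →
      ∀ (Ω : Type*) [MeasurableSpace Ω] (P : Measure Ω) [IsProbabilityMeasure P]
        (x : Ω → EuclideanSpace ℝ (Fin p)) (X : Fin n → Ω → EuclideanSpace ℝ (Fin p)),
        HasGaussianLaw x P → ∫ ω, x ω ∂P = 0 →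
        iIndepFun X P → (∀ i, IdentDistrib (X i) x P P) →
        -- the bound for an arbitrary symmetric mask
        (∀ M : Matrix (Fin p) (Fin p) ℝ, M.IsSymm →
          Integrable (fun ω => ‖MaskedCov.fluctuation P x X M ω‖ ^ 2) P ∧
          MaskedCov.rmsFluctuation P x X M ≤
            C * (√(MaskedCov.maxNorm (MaskedCov.covMatrix P x) / ‖MaskedCov.covMatrix P x‖ *
                    (MaskedCov.colNorm M ^ 2 * Real.log p / n)) +
                  MaskedCov.maxNorm (MaskedCov.covMatrix P x) / ‖MaskedCov.covMatrix P x‖ *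
                    (‖M‖ * Real.log p * Real.log (n * p) / n)) *
              ‖MaskedCov.covMatrix P x‖) ∧
        -- the sample complexity for a banded mask of bandwidth `2 * b + 1`
        (∀ (b : ℕ) (M : Matrix (Fin p) (Fin p) ℝ), MaskedCov.IsBandedMask b M →
          ∀ ε : ℝ, 0 < ε → ε < 1 →
          (C * ((2 * b + 1) * Real.log p / ε ^ 2 + (2 * b + 1) * Real.log p ^ 2 / ε) *
              (MaskedCov.maxNorm (MaskedCov.covMatrix P x) / ‖MaskedCov.covMatrix P x‖) ≤ n ∨
            C * ((2 * b + 1) * Real.log p ^ 2) / ε ^ 2 ≤ n) →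
          MaskedCov.rmsFluctuation P x X M ≤ ε * ‖MaskedCov.covMatrix P x‖ ∧
          99 / 100 ≤
            P.real {ω | ‖MaskedCov.fluctuation P x X M ω‖ ≤ ε * ‖MaskedCov.covMatrix P x‖}) := by
  -- The factor 2 reduces the second sample-size condition to the first: as log p ≥ 1, ε < 1 and the
  -- ratio is at most 1, each of the two terms is at most B log² p / ε².
  refine ⟨2 * 10 ^ 10, by norm_num, fun p n hp hn Ω _ P _ x X hx h0 hX hid => ?_⟩
  have hp' : (3 : ℝ) ≤ p := by exact_mod_cast hp
  have hn' : (1 : ℝ) ≤ n := by exact_mod_cast hn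
  have hL1 : 1 ≤ Real.log p := by
    rw [Real.le_log_iff_exp_le (by linarith)]
    linarith [Real.exp_one_lt_d9]
  have hlog : 0 ≤ Real.log (n * p) := Real.log_nonneg (by nlinarith)
  have hr0 : 0 ≤ MaskedCov.maxNorm (MaskedCov.covMatrix P x) / ‖MaskedCov.covMatrix P x‖ :=
    div_nonneg (MaskedCov.maxNorm_nonneg _) (norm_nonneg _)
  have hr1 : MaskedCov.maxNorm (MaskedCov.covMatrix P x) / ‖MaskedCov.covMatrix P x‖ ≤ 1 :=
    div_le_one_of_le₀ (MaskedCov.maxNorm_le_norm _) (norm_nonneg _)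
  refine ⟨fun M hM => ⟨(MaskedCov.integral_norm_fluctuation_sq_le hp hn hx h0 hX hid hM).1, ?_⟩,
    fun b M hM ε hε hε1 h => ?_⟩
  · refine (MaskedCov.rmsFluctuation_le hp hn hx h0 hX hid hM).trans ?_
    gcongr
    norm_num
  · have hrms := MaskedCov.rmsFluctuation_le hp hn hx h0 hX hid hM.symm
    have hbound : 10 ^ 10 * ((2 * b + 1) * Real.log p / ε ^ 2
        + (2 * b + 1) * Real.log p ^ 2 / ε)
        * (MaskedCov.maxNorm (MaskedCov.covMatrix P x) / ‖MaskedCov.covMatrix P x‖) ≤ n := by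
      rcases h with h | h
      · refine le_trans ?_ h
        gcongr
        norm_num
      · refine le_trans ?_ h
        have h1 : (2 * b + 1) * Real.log p / ε ^ 2 ≤ (2 * b + 1) * Real.log p ^ 2 / ε ^ 2 := by
          gcongr
          nlinarith
        have h2 : (2 * b + 1) * Real.log p ^ 2 / ε ≤ (2 * b + 1) * Real.log p ^ 2 / ε ^ 2 := by
          gcongr
          nlinarith
        calc _ ≤ 10 ^ 10 * ((2 * b + 1) * Real.log p ^ 2 / ε ^ 2
              + (2 * b + 1) * Real.log p ^ 2 / ε ^ 2) * 1 := by gcongr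
          _ = _ := by ring
    have herr := MaskedCov.relative_error_le hp' hn' hr0 hr1 (sq_nonneg _)
      hM.colNorm_sq_le hM.norm_le (min_le_left _ _) (min_le_right _ _) hε hbound
    have hle : MaskedCov.rmsFluctuation P x X M ≤ ε * ‖MaskedCov.covMatrix P x‖ / 10 := by
      refine hrms.trans ((mul_le_mul_of_nonneg_right herr (norm_nonneg _)).trans_eq ?_)
      ring
    have hs : 0 ≤ ε * ‖MaskedCov.covMatrix P x‖ := by positivity
    exact ⟨hle.trans (by linarith), MaskedCov.prob_le_of_sqrt_integral_sq_le
      (MaskedCov.integral_norm_fluctuation_sq_le hp hn hx h0 hX hid hM.symm).1 hs hle⟩
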